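/- Let $m\ge 1$, let $q=2^s$ with $s\ge 1$, and let $S=S_m=\mathbb{F}_q[y_1,\ldots,y_m,x_m,\ldots,x_1]$. Put $\overline{\xi}_0=x_1y_1+\cdots+x_my_m\in S$, $\xi_0=z^2+\overline{\xi}_0\in S[z]$ and $\xi_i=\sum_{j=1}^m\bigl(x_jy_j^{q^i}+y_jx_j^{q^i}\bigr)$ for $i>0$. Let $O_{2m+1}(\mathbb{F}_q)$ be the subgroup of $GL_{2m+1}(\mathbb{F}_q)$, acting on $S[z]$ by linear substitutions of the variables $y_1,\ldots,y_m,z,x_m,\ldots,x_1$, which fixes $\xi_0$. Let $d_{1,m}\in S$ be the Dickson invariant given by the coefficient of $t^{q^{2m-1}-1}$ in $\prod_v (t-v)$, where $v$ runs over the nonzero $\mathbb{F}_q$-linear forms in the variables of $S$. Let $u_m=\prod_{i=1}^m N(y_i)N(x_i)\in S_m$, where $N(v)$ is the product of all forms $v+\ell$ with $\ell$ an $\mathbb{F}_q$-linear combination of the variables after $v$ in the list $y_1,\ldots,y_m,x_m,\ldots,x_1$; in particular $u_0=1$. The element $u_{m-1}\in S_{m-1}$ is a polynomial in $\xi_1,\ldots,\xi_{2m-3}\in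 S_{m-1}$, and it is regarded as an element of $S_m$ by evaluating the same polynomial at $\xi_1,\ldots,\xi_{2m-3}\in S_m$. A monomial $\xi_1^{a_1}\cdots\xi_N^{a_N}$ is called natural if the base $q$ expansions of all $a_k$ involve only the digits $0$ and $1$; its natural degree is the total number of digits $1$ in these expansions, and its degree is $\sum_k a_k(q^k+1)$. For $0<j<k<2m-1$ let $\delta_{jk}\in S$ be the sum of the natural monomials in $\xi_1,\ldots,\xi_{2m-2}$ of degree $q+q^2+\cdots+q^{2m-2}-q^j-q^k$ and natural degree $m-2$, and put $\delta_1=\sum_{0<j<k<2m-1}\xi_j\xi_k\delta_{jk}$. Then there is a unique polynomial $e_1=u_m^{q/2-1}u_{m-1}^{q/2}\,z+b_1\in S[z]$ with $b_1\in S$ and $$b_1^2=d_{1,m}+u_m^{q-2}\bigl(\delta_1+\overline{\xi}_0\,u_{m-1}^q\bigr),$$ and, inside the field of fractions of $S[z]$, the field of fractions of the ring of invariants $S[z]^{O_{2m+1}(\mathbb{F}_q)}$ is $$\mathcal{Q}\bigl(S[z]^{O_{2m+1}(\mathbb{F}_q)}\bigr)=\mathbb{F}_q(\xi_1,\ldots,\xi_{2m},e_1).$$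 -/

import Mathlib

noncomputable section

namespace OrthInv

open MvPolynomial

/-- Substitution action of a matrix `g` on polynomials: `f ↦ f ∘ g`, so that the coordinate
function `X i` is sent to the linear form `v ↦ (g v) i`. -/
def subst {n F : Type*} [Fintype n] [Field F] (g : Matrix n n F) :
    MvPolynomial n F →ₐ[F] MvPolynomial n F :=
  aeval fun i => ∑ j, C (g i j) * X j

theorem subst_X {n F : Type*} [Fintype n] [Field F] (g : Matrix n n F) (i : n) :
    subst g (X i) = ∑ j, C (g i j) * X j := by
  simp [subst]

theorem subst_one {n F : Type*} [Fintype n] [DecidableEq n] [Field F] (f : MvPolynomial n F) :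
    subst (1 : Matrix n n F) f = f := by
  have h : subst (1 : Matrix n n F) = AlgHom.id F _ := by
    apply MvPolynomial.algHom_ext
    intro i
    rw [subst_X, Finset.sum_eq_single i]
    · simp
    · intro j _ hj
      simp [Matrix.one_apply_ne hj.symm]
    · simp
  rw [h]
  rfl

theorem subst_mul {n F : Type*} [Fintype n] [Field F] (g h : Matrix n n F)
    (f : MvPolynomial n F) : subst (g * h) f = subst h (subst g f) := by
  have hh : subst (g * h) = (subst h).comp (subst g) := by
    apply MvPolynomial.algHom_ext
    intro i
    simp only [AlgHom.comp_apply, subst_X, map_sum, map_mul, Matrix.mul_apply, algHom_C,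
      algebraMap_eq, Finset.sum_mul, Finset.mul_sum]
    rw [Finset.sum_comm]
    simp [mul_assoc]
  rw [hh]
  rfl

/-- The subgroup of `GL` fixing the polynomial `f`. -/
def fixer {n F : Type*} [Fintype n] [DecidableEq n] [Field F] (f : MvPolynomial n F) :
    Subgroup (Matrix.GeneralLinearGroup n F) where
  carrier := {g | subst (g : Matrix n n F) f = f}
  one_mem' := by simpa using subst_one f
  mul_mem' := by
    intro a b ha hb
    simp only [Set.mem_ofPred_eq] at ha hb ⊢
    rw [Matrix.GeneralLinearGroup.coe_mul, subst_mul, ha, hb]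
  inv_mem' := by
    intro a ha
    simp only [Set.mem_ofPred_eq] at ha ⊢
    conv_lhs => rw [← ha]
    rw [← subst_mul, ← Matrix.GeneralLinearGroup.coe_mul, mul_inv_cancel]
    simpa using subst_one f

/-- The ring of polynomials invariant under the group `G`. -/
def invariants {n F : Type*} [Fintype n] [DecidableEq n] [Field F]
    (G : Subgroup (Matrix.GeneralLinearGroup n F)) : Subalgebra F (MvPolynomial n F) where
  carrier := {f | ∀ g ∈ G, subst (g : Matrix n n F) f = f}
  mul_mem' := by
    intro a b ha hb g hg
    rw [map_mul, ha g hg, hb g hg]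
  add_mem' := by
    intro a b ha hb g hg
    rw [map_add, ha g hg, hb g hg]
  algebraMap_mem' := by
    intro r g _
    exact (subst (g : Matrix n n F)).commutes r

/-- The field of fractions of a subalgebra `A` of a domain `R`, realised inside the field of
fractions of `R` as the subfield generated by `A`. -/
def fieldOfFractions {F R : Type*} [Field F] [CommRing R] [IsDomain R] [Algebra F R]
    (A : Subalgebra F R) : IntermediateField F (FractionRing R) :=
  IntermediateField.adjoin F (algebraMap R (FractionRing R) '' (A : Set R))

/-- The elements of `fieldOfFractions A` are exactly the quotients `a / b` with `a, b ∈ A`. -/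
theorem mem_fieldOfFractions {F R : Type*} [Field F] [CommRing R] [IsDomain R] [Algebra F R]
    (A : Subalgebra F R) (x : FractionRing R) :
    x ∈ fieldOfFractions A ↔ ∃ a ∈ A, ∃ b ∈ A,
      x = algebraMap R (FractionRing R) a / algebraMap R (FractionRing R) b := by
  have key : Algebra.adjoin F (algebraMap R (FractionRing R) '' (A : Set R)) =
      A.map (IsScalarTower.toAlgHom F R (FractionRing R)) := by
    have : algebraMap R (FractionRing R) '' (A : Set R) =
      (A.map (IsScalarTower.toAlgHom F R (FractionRing R)) : Set (FractionRing R)) := by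
      ext; simp
    rw [this, Algebra.adjoin_eq]
  rw [fieldOfFractions, IntermediateField.mem_adjoin_iff_div, key]
  constructor
  · rintro ⟨_, ⟨a, ha, rfl⟩, _, ⟨b, hb, rfl⟩, h⟩
    exact ⟨a, ha, b, hb, h⟩
  · rintro ⟨a, ha, b, hb, h⟩
    exact ⟨_, ⟨a, ha, rfl⟩, _, ⟨b, hb, rfl⟩, h⟩

section

variable (F : Type*) [Field F] [Fintype F] (m : ℕ)

/-- `S = F[y_1, …, y_m, x_m, …, x_1]`: `Sum.inl j` indexes `y_{j+1}` and `Sum.inr j` indexes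
`x_{j+1}`. -/
abbrev S : Type _ := MvPolynomial (Fin m ⊕ Fin m) F

/-- `S[z]`: the extra index `none` is the variable `z`. -/
abbrev Sz : Type _ := MvPolynomial (Option (Fin m ⊕ Fin m)) F

def y (j : Fin m) : S F m := X (Sum.inl j)

def x (j : Fin m) : S F m := X (Sum.inr j)

def z : Sz F m := X none

/-- The inclusion of `S` in `S[z]`. -/
def incl : S F m →ₐ[F] Sz F m := rename some

/-- `x_1 y_1 + ⋯ + x_m y_m`. -/
def xiBar : S F m := ∑ j, x F m j * y F m j

/-- The quadratic form `ξ_0 = z² + x_1 y_1 + ⋯ + x_m y_m`. -/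
def xiZero : Sz F m := z F m ^ 2 + incl F m (xiBar F m)

/-- `ξ_i = ∑_j (x_j y_j^{q^i} + y_j x_j^{q^i})` for `i > 0`. -/
def xi (i : ℕ) : S F m :=
  ∑ j, (x F m j * y F m j ^ Fintype.card F ^ i + y F m j * x F m j ^ Fintype.card F ^ i)

/-- The orthogonal group `O_{2m+1}(F)`: the subgroup of `GL_{2m+1}(F)` fixing `ξ_0`. -/
def orthogonalGroup : Subgroup (Matrix.GeneralLinearGroup (Option (Fin m ⊕ Fin m)) F) :=
  fixer (xiZero F m)

/-- The linear form in `S` with coefficients `c`. -/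
def linForm (c : Fin m ⊕ Fin m → F) : S F m := ∑ i, C (c i) * X i

open scoped Classical in
/-- The Dickson invariant `d_{i,m}` of `GL_{2m}(F)` acting on `S`: the coefficient of
`t^{q^{2m-i}-1}` in the product of `t - v` over the nonzero linear forms `v`
(the `GL_{2m}(F)`-orbit of `x_1`). -/
def dickson (i : ℕ) : S F m :=
  (∏ c ∈ (Finset.univ : Finset (Fin m ⊕ Fin m → F)).filter (fun c => c ≠ 0),
    (Polynomial.X - Polynomial.C (linForm F m c))).coeff (Fintype.card F ^ (2 * m - i) - 1)

/-- The position of a variable in the ordered basis `y_1, …, y_m, x_m, …, x_1`. -/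
def pos : Fin m ⊕ Fin m → ℕ
  | Sum.inl j => j
  | Sum.inr j => 2 * m - 1 - j

open scoped Classical in
/-- The orbit product `N(v)` of the variable `v` with index `i` under the unitriangular group:
the orbit consists of the sums of `v` and a linear combination of the variables after `v`. -/
def orbitProd (i : Fin m ⊕ Fin m) : S F m :=
  ∏ c ∈ (Finset.univ : Finset (Fin m ⊕ Fin m → F)).filter
      (fun c => c i = 1 ∧ ∀ k, pos m k < pos m i → c k = 0),
    linForm F m c

/-- `u_m = ∏_i N(y_i) N(x_i)`. -/
def u : S F m := ∏ i, orbitProd F m i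

/-- `w ∈ S_m` is `u_{m-1}` interpreted in `S_m`, i.e. the image of `u_{m-1} ∈ S_{m-1}` under the
map sending a polynomial in `ξ_1, …, ξ_{2m-3} ∈ S_{m-1}` to the same polynomial in
`ξ_1, …, ξ_{2m-3} ∈ S_m`. -/
def IsUPrev (w : S F m) : Prop :=
  ∃ P : MvPolynomial (Fin (2 * m - 3)) F,
    aeval (fun i : Fin (2 * m - 3) => xi F (m - 1) ((i : ℕ) + 1)) P = u F (m - 1) ∧
    w = aeval (fun i : Fin (2 * m - 3) => xi F m ((i : ℕ) + 1)) P

/-- The exponent vector `a` describes the monomial `∏_i ξ_{i+1}^{a i}` in `ξ_1, …, ξ_N`. It is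
natural if the base `q` expansions of all exponents involve only the digits `0` and `1`. -/
def IsNatural {N : ℕ} (a : Fin N → ℕ) : Prop :=
  ∀ i, ∀ d ∈ Nat.digits (Fintype.card F) (a i), d ≤ 1

/-- The degree of `∏_i ξ_{i+1}^{a i}`, where `ξ_i` has degree `q^i + 1`. -/
def monDegree {N : ℕ} (a : Fin N → ℕ) : ℕ :=
  ∑ i : Fin N, a i * (Fintype.card F ^ ((i : ℕ) + 1) + 1)

/-- The natural degree of a natural monomial: the number of its natural factors `ξ_j^{q^r}`,
i.e. the number of digits `1` in the base `q` expansions of the exponents. -/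
def naturalDegree {N : ℕ} (a : Fin N → ℕ) : ℕ :=
  ∑ i, (Nat.digits (Fintype.card F) (a i)).count 1

open scoped Classical in
/-- The sum of the natural monomials in `ξ_1, …, ξ_N ∈ S_m` of degree `D` and natural degree `k`.
(All exponents of a monomial of degree `D` are at most `D`.) -/
def naturalSum (N D k : ℕ) : S F m :=
  ∑ a ∈ (Fintype.piFinset fun _ : Fin N => Finset.range (D + 1)).filter
      (fun a => IsNatural F a ∧ monDegree F a = D ∧ naturalDegree F a = k),
    ∏ i : Fin N, xi F m ((i : ℕ) + 1) ^ a i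

/-- `δ_{jk}`: the sum of the natural monomials in `ξ_1, …, ξ_{2m-2}` of degree
`q + q² + ⋯ + q^{2m-2} - q^j - q^k` and natural degree `m - 2`. It is used only for
`0 < j < k < 2m - 1`, where no subtraction truncates. -/
def deltaPair (j k : ℕ) : S F m :=
  naturalSum F m (2 * m - 2)
    ((∑ i ∈ Finset.Icc 1 (2 * m - 2), Fintype.card F ^ i) - Fintype.card F ^ j -
      Fintype.card F ^ k) (m - 2)

/-- `δ_1 = ∑_{0 < j < k < 2m-1} ξ_j ξ_k δ_{jk}`. -/
def deltaOne : S F m :=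
  ∑ k ∈ Finset.Ioo 0 (2 * m - 1), ∑ j ∈ Finset.Ioo 0 k, xi F m j * xi F m k * deltaPair F m j k

/-- `e` is the polynomial `e_1 = u_m^{q/2-1} u_{m-1}^{q/2} z + b_1`, where `b_1 ∈ S` is determined
by `b_1² = d_{1,m} + u_m^{q-2} (δ_1 + (x_1 y_1 + ⋯ + x_m y_m) u_{m-1}^q)`. -/
def IsEOne (e : Sz F m) : Prop :=
  ∃ w b : S F m, IsUPrev F m w ∧
    b ^ 2 = dickson F m 1 + u F m ^ (Fintype.card F - 2) *
      (deltaOne F m + xiBar F m * w ^ Fintype.card F) ∧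
    e = incl F m (u F m ^ (Fintype.card F / 2 - 1) * w ^ (Fintype.card F / 2)) * z F m +
      incl F m b

end

end OrthInv

end

noncomputable section

namespace OrthInv

set_option linter.unusedSectionVars false

section

open Finset

/-- `T` is a perfect matching of `I`, a pair being written with its smaller element first. -/
def IsMatching (I : Finset ℕ) (T : Finset (ℕ × ℕ)) : Prop :=
  (∀ p ∈ T, p.1 < p.2 ∧ p.1 ∈ I ∧ p.2 ∈ I) ∧ ∀ i ∈ I, ∃! p, p ∈ T ∧ (p.1 = i ∨ p.2 = i)

open scoped Classical in
def matchings (I : Finset ℕ) : Finset (Finset (ℕ × ℕ)) :=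
  (I ×ˢ I).powerset.filter (IsMatching I)

theorem mem_matchings {I : Finset ℕ} {T : Finset (ℕ × ℕ)} :
    T ∈ matchings I ↔ IsMatching I T := by
  classical
  simp only [matchings, mem_filter, mem_powerset, and_iff_right_iff_imp]
  intro h p hp
  exact mem_product.2 (h.1 p hp).2

/-- The Pfaffian of the entries `B i j`, `i, j ∈ I`, without signs. -/
def pf {R : Type*} [CommRing R] (I : Finset ℕ) (B : ℕ → ℕ → R) : R :=
  ∑ T ∈ matchings I, ∏ p ∈ T, B p.1 p.2

section

variable {R : Type*} [CommRing R]

theorem pf_congr {I : Finset ℕ} {B B' : ℕ → ℕ → R}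
    (h : ∀ i ∈ I, ∀ j ∈ I, i < j → B i j = B' i j) : pf I B = pf I B' := by
  refine sum_congr rfl fun T hT => prod_congr rfl fun p hp => ?_
  obtain ⟨h1, h2, h3⟩ := (mem_matchings.1 hT).1 p hp
  exact h _ h2 _ h3 h1

theorem map_pf {R' : Type*} [CommRing R'] (f : R →+* R') (I : Finset ℕ) (B : ℕ → ℕ → R) :
    f (pf I B) = pf I fun i j => f (B i j) := by
  simp [pf, map_sum, map_prod]

theorem pf_mem {A : Type*} [SetLike A R] [SubringClass A R] (s : A) {I : Finset ℕ}
    {B : ℕ → ℕ → R} (h : ∀ i ∈ I, ∀ j ∈ I, i < j → B i j ∈ s) : pf I B ∈ s := by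
  refine sum_mem fun T hT => prod_mem fun p hp => ?_
  obtain ⟨h1, h2, h3⟩ := (mem_matchings.1 hT).1 p hp
  exact h _ h2 _ h3 h1

theorem IsMatching.eq_of_mem {I : Finset ℕ} {T : Finset (ℕ × ℕ)} (h : IsMatching I T)
    {p p' : ℕ × ℕ} (hp : p ∈ T) (hp' : p' ∈ T) {i : ℕ} (hi : p.1 = i ∨ p.2 = i)
    (hi' : p'.1 = i ∨ p'.2 = i) : p = p' := by
  have hI : i ∈ I := by
    rcases hi with rfl | rfl
    · exact (h.1 p hp).2.1
    · exact (h.1 p hp).2.2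
  exact (h.2 i hI).unique ⟨hp, hi⟩ ⟨hp', hi'⟩

theorem isMatching_insert {I : Finset ℕ} {T : Finset (ℕ × ℕ)} {i j : ℕ} (hi : i ∈ I)
    (hj : j ∈ I) (hij : i < j) (h : IsMatching ((I.erase i).erase j) T) :
    IsMatching I (insert (i, j) T) := by
  have key : ∀ p ∈ T, p.1 ≠ i ∧ p.2 ≠ i ∧ p.1 ≠ j ∧ p.2 ≠ j := by
    intro p hp
    have := h.1 p hp
    simp only [mem_erase] at this
    tauto
  constructor
  · intro p hp
    rcases mem_insert.1 hp with rfl | hp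
    · exact ⟨hij, hi, hj⟩
    · have := h.1 p hp
      simp only [mem_erase] at this
      tauto
  · intro k hk
    by_cases hki : k = i
    · refine ⟨(i, j), ⟨mem_insert_self _ _, Or.inl hki.symm⟩, ?_⟩
      rintro p ⟨hp, hpk⟩
      rcases mem_insert.1 hp with rfl | hp
      · rfl
      · have := key p hp
        grind
    · by_cases hkj : k = j
      · refine ⟨(i, j), ⟨mem_insert_self _ _, Or.inr hkj.symm⟩, ?_⟩
        rintro p ⟨hp, hpk⟩
        rcases mem_insert.1 hp with rfl | hp
        · rfl
        · have := key p hp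
          grind
      · obtain ⟨p, ⟨hp, hpk⟩, hu⟩ := h.2 k (by simp [hki, hkj, hk])
        refine ⟨p, ⟨mem_insert_of_mem hp, hpk⟩, ?_⟩
        rintro p' ⟨hp', hpk'⟩
        rcases mem_insert.1 hp' with rfl | hp'
        · grind
        · exact hu p' ⟨hp', hpk'⟩

theorem IsMatching.erase {I : Finset ℕ} {T : Finset (ℕ × ℕ)} {i j : ℕ}
    (h : IsMatching I T) (hT : (i, j) ∈ T) :
    IsMatching ((I.erase i).erase j) (T.erase (i, j)) := by
  constructor
  · intro p hp
    obtain ⟨hne, hp⟩ := mem_erase.1 hp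
    obtain ⟨h1, h2, h3⟩ := h.1 p hp
    have a1 : p.1 ≠ i := fun e => hne (h.eq_of_mem hp hT (Or.inl e) (Or.inl rfl))
    have a2 : p.2 ≠ i := fun e => hne (h.eq_of_mem hp hT (Or.inr e) (Or.inl rfl))
    have a3 : p.1 ≠ j := fun e => hne (h.eq_of_mem hp hT (Or.inl e) (Or.inr rfl))
    have a4 : p.2 ≠ j := fun e => hne (h.eq_of_mem hp hT (Or.inr e) (Or.inr rfl))
    simp [*]
  · intro k hk
    simp only [mem_erase] at hk
    obtain ⟨p, ⟨hp, hpk⟩, hu⟩ := h.2 k hk.2.2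
    refine ⟨p, ⟨mem_erase.2 ⟨?_, hp⟩, hpk⟩, ?_⟩
    · rintro rfl
      grind
    · rintro p' ⟨hp', hpk'⟩
      exact hu p' ⟨(mem_erase.1 hp').2, hpk'⟩

theorem pf_expand {I : Finset ℕ} {i : ℕ} (hi : i ∈ I) (hmin : ∀ k ∈ I, i ≤ k)
    (B : ℕ → ℕ → R) :
    pf I B = ∑ j ∈ I.erase i, B i j * pf ((I.erase i).erase j) B := by
  classical
  simp only [pf, mul_sum]
  rw [sum_sigma']
  symm
  refine sum_bij (fun a _ => insert (i, a.1) a.2) ?_ ?_ ?_ ?_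
  · rintro ⟨j, T⟩ ha
    simp only [mem_sigma, mem_matchings] at ha
    have hj := mem_erase.1 ha.1
    exact mem_matchings.2 (isMatching_insert hi hj.2
      (lt_of_le_of_ne (hmin _ hj.2) hj.1.symm) ha.2)
  · rintro ⟨j, T⟩ ha ⟨j', T'⟩ ha' heq
    simp only [mem_sigma, mem_matchings] at ha ha' heq
    have n1 : ∀ k, (i, k) ∉ T := fun k hk => by
      have := (ha.2.1 _ hk).2.1
      simp at this
    have n2 : ∀ k, (i, k) ∉ T' := fun k hk => by
      have := (ha'.2.1 _ hk).2.1
      simp at this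
    have hj : j = j' := by
      have : (i, j) ∈ insert (i, j') T' := heq ▸ mem_insert_self _ _
      rcases mem_insert.1 this with h | h
      · exact (Prod.ext_iff.1 h).2
      · exact absurd h (n2 _)
    subst hj
    have : T = T' := by
      rw [← erase_insert (n1 j), ← erase_insert (n2 j), heq]
    rw [this]
  · intro T hT
    have hT := mem_matchings.1 hT
    obtain ⟨p, ⟨hp, hpi⟩, -⟩ := hT.2 i hi
    obtain ⟨h1, h2, h3⟩ := hT.1 p hp
    have hp1 : p.1 = i := by
      rcases hpi with h | h
      · exact h
      · have := hmin _ h2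
        omega
    have hpe : (i, p.2) = p := by rw [← hp1]
    refine ⟨⟨p.2, T.erase p⟩, ?_, ?_⟩
    · simp only [mem_sigma, mem_matchings, mem_erase]
      refine ⟨⟨by omega, h3⟩, ?_⟩
      have := hT.erase (hpe.symm ▸ hp : (i, p.2) ∈ T)
      rwa [hpe] at this
    · simp only [hpe]
      exact insert_erase hp
  · rintro ⟨j, T⟩ ha
    simp only [mem_sigma, mem_matchings] at ha
    rw [prod_insert]
    intro hk
    have := (ha.2.1 _ hk).2.1
    simp at this

theorem pf_empty (B : ℕ → ℕ → R) : pf ∅ B = 1 := by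
  have : matchings ∅ = {∅} := by
    ext T
    rw [mem_matchings, mem_singleton]
    constructor
    · intro h
      rw [eq_empty_iff_forall_notMem]
      intro p hp
      simpa using (h.1 p hp).2.1
    · rintro rfl
      simp [IsMatching]
  simp [pf, this]

/-- A sum over permutations of terms invariant under inversion reduces, in characteristic two, to
the involutions. -/
theorem sum_perm_eq_sum_involutions [CharP R 2] {ι : Type*} [Fintype ι] [DecidableEq ι]
    (f : Equiv.Perm ι → R) (hf : ∀ σ, f σ⁻¹ = f σ) :
    ∑ σ, f σ = ∑ σ ∈ univ.filter (fun σ : Equiv.Perm ι => σ⁻¹ = σ), f σ := by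
  rw [← sum_filter_add_sum_filter_not univ (fun σ : Equiv.Perm ι => σ⁻¹ = σ)]
  rw [add_eq_left]
  refine sum_involution (fun σ _ => σ⁻¹) ?_ ?_ ?_ ?_
  · intro σ _
    rw [hf, CharTwo.add_self_eq_zero]
  · intro σ hσ _
    exact (mem_filter.1 hσ).2
  · intro σ hσ
    have := (mem_filter.1 hσ).2
    simp only [mem_filter, mem_univ, true_and, inv_inv]
    exact fun h => this h.symm
  · intro σ _
    exact inv_inv σ

theorem apply_apply_of_inv_eq_self {ι : Type*} {σ : Equiv.Perm ι} (h : σ⁻¹ = σ) (i : ι) :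
    σ (σ i) = i := by
  have := mul_inv_cancel σ
  rw [h] at this
  exact Equiv.congr_fun this i

/-- The pairs of a fixed point free involution. -/
def pairs {n : ℕ} (σ : Equiv.Perm (Fin n)) : Finset (ℕ × ℕ) :=
  (univ.filter fun i : Fin n => i < σ i).image fun i : Fin n => ((i : ℕ), (σ i : ℕ))

theorem mem_pairs {n : ℕ} {σ : Equiv.Perm (Fin n)} {p : ℕ × ℕ} :
    p ∈ pairs σ ↔ ∃ i : Fin n, i < σ i ∧ p = ((i : ℕ), (σ i : ℕ)) := by
  simp [pairs, eq_comm]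

theorem isMatching_pairs {n : ℕ} {σ : Equiv.Perm (Fin n)} (h : σ⁻¹ = σ) (h' : ∀ i, σ i ≠ i) :
    IsMatching (range n) (pairs σ) := by
  have hσ : ∀ i, σ (σ i) = i := fun i => apply_apply_of_inv_eq_self h i
  constructor
  · intro p hp
    obtain ⟨i, hi, rfl⟩ := mem_pairs.1 hp
    exact ⟨hi, by simp, by simp⟩
  · intro i hi
    lift i to Fin n using mem_range.1 hi
    rcases lt_or_gt_of_ne (h' i) with hlt | hgt
    · refine ⟨((σ i : ℕ), (i : ℕ)), ⟨mem_pairs.2 ⟨σ i, by rwa [hσ], by rw [hσ]⟩, Or.inr rfl⟩, ?_⟩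
      rintro p ⟨hp, hpi⟩
      obtain ⟨j, hj, rfl⟩ := mem_pairs.1 hp
      rcases hpi with e | e
      · have := Fin.ext e
        subst this
        exact absurd hj hlt.not_gt
      · have := Fin.ext e
        subst this
        rw [hσ]
    · refine ⟨((i : ℕ), (σ i : ℕ)), ⟨mem_pairs.2 ⟨i, hgt, rfl⟩, Or.inl rfl⟩, ?_⟩
      rintro p ⟨hp, hpi⟩
      obtain ⟨j, hj, rfl⟩ := mem_pairs.1 hp
      rcases hpi with e | e
      · have := Fin.ext e
        subst this
        rfl
      · have := Fin.ext e
        subst this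
        rw [hσ] at hgt
        exact absurd hj hgt.not_gt

theorem pairs_injective {n : ℕ} {σ τ : Equiv.Perm (Fin n)} (hσ : σ⁻¹ = σ) (hσ' : ∀ i, σ i ≠ i)
    (hτ : τ⁻¹ = τ) (h : pairs σ = pairs τ) : σ = τ := by
  have eσ : ∀ i, σ (σ i) = i := fun i => apply_apply_of_inv_eq_self hσ i
  have eτ : ∀ i, τ (τ i) = i := fun i => apply_apply_of_inv_eq_self hτ i
  have key : ∀ i, i < σ i → τ i = σ i := by
    intro i hi
    have : ((i : ℕ), (σ i : ℕ)) ∈ pairs τ := h ▸ mem_pairs.2 ⟨i, hi, rfl⟩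
    obtain ⟨j, hj, e⟩ := mem_pairs.1 this
    obtain ⟨e1, e2⟩ := Prod.ext_iff.1 e
    have e1 := Fin.ext e1
    subst e1
    exact (Fin.ext e2).symm
  ext1 i
  rcases lt_or_gt_of_ne (hσ' i) with hlt | hgt
  · have := key (σ i) (by rwa [eσ])
    rw [eσ] at this
    conv_rhs => rw [← this]
    rw [eτ]
  · exact (key i hgt).symm

theorem exists_pairs_eq {n : ℕ} {T : Finset (ℕ × ℕ)} (h : IsMatching (range n) T) :
    ∃ σ : Equiv.Perm (Fin n), σ⁻¹ = σ ∧ (∀ i, σ i ≠ i) ∧ pairs σ = T := by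
  have ex : ∀ i : Fin n, ∃ j : Fin n, ((i : ℕ), (j : ℕ)) ∈ T ∨ ((j : ℕ), (i : ℕ)) ∈ T := by
    intro i
    obtain ⟨p, ⟨hp, hpi⟩, -⟩ := h.2 i (by simp)
    obtain ⟨h1, h2, h3⟩ := h.1 p hp
    rcases hpi with e | e
    · exact ⟨⟨p.2, mem_range.1 h3⟩, Or.inl (by rw [← e]; exact hp)⟩
    · exact ⟨⟨p.1, mem_range.1 h2⟩, Or.inr (by rw [← e]; exact hp)⟩
  choose f hf using ex
  have hun : ∀ i j : Fin n, ((i : ℕ), (j : ℕ)) ∈ T ∨ ((j : ℕ), (i : ℕ)) ∈ T → f i = j := by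
    intro i j hj
    apply Fin.ext
    rcases hf i with h1 | h1 <;> rcases hj with h2 | h2
    · exact (Prod.ext_iff.1 (h.eq_of_mem h1 h2 (i := i) (by simp) (by simp))).2
    · have e := Prod.ext_iff.1 (h.eq_of_mem h1 h2 (i := i) (by simp) (by simp))
      exact e.2.trans e.1
    · have e := Prod.ext_iff.1 (h.eq_of_mem h1 h2 (i := i) (by simp) (by simp))
      exact e.1.trans e.2
    · exact (Prod.ext_iff.1 (h.eq_of_mem h1 h2 (i := i) (by simp) (by simp))).1
  have hinv : Function.Involutive f := fun i => hun _ _ (hf i).symm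
  refine ⟨hinv.toPerm f, ?_, ?_, ?_⟩
  · rw [inv_eq_iff_mul_eq_one]
    ext1 i
    exact hinv i
  · intro i e
    change f i = i at e
    have := hf i
    rw [e] at this
    simpa using (h.1 _ (this.elim id id)).1
  · ext p
    rw [mem_pairs]
    constructor
    · rintro ⟨i, hi, rfl⟩
      change i < f i at hi
      rcases hf i with h1 | h1
      · exact h1
      · exact absurd (h.1 _ h1).1 (not_lt.2 (Fin.le_def.1 hi.le))
    · intro hp
      obtain ⟨h1, h2, h3⟩ := h.1 p hp
      have := hun ⟨p.1, mem_range.1 h2⟩ ⟨p.2, mem_range.1 h3⟩ (Or.inl hp)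
      refine ⟨⟨p.1, mem_range.1 h2⟩, ?_, ?_⟩
      · change _ < f _
        rw [this]
        exact h1
      · change _ = (_, ((f _ : Fin n) : ℕ))
        rw [this]

theorem prod_involution_eq_sq {n : ℕ} (B : ℕ → ℕ → R) (hsymm : ∀ i j, B i j = B j i)
    {σ : Equiv.Perm (Fin n)} (h : σ⁻¹ = σ) (h' : ∀ i, σ i ≠ i) :
    ∏ i : Fin n, B (σ i) i = (∏ p ∈ pairs σ, B p.1 p.2) ^ 2 := by
  have eσ : ∀ i, σ (σ i) = i := fun i => apply_apply_of_inv_eq_self h i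
  have h1 : ∏ p ∈ pairs σ, B p.1 p.2 = ∏ i ∈ univ.filter (fun i : Fin n => i < σ i), B i (σ i) := by
    rw [pairs, prod_image]
    intro i _ j _ e
    exact Fin.ext (Prod.ext_iff.1 e).1
  have h2 : ∏ i ∈ univ.filter (fun i : Fin n => ¬ i < σ i), B (σ i) i =
      ∏ i ∈ univ.filter (fun i : Fin n => i < σ i), B i (σ i) := by
    refine prod_bij (fun i _ => σ i) ?_ ?_ ?_ ?_
    · intro i hi
      simp only [mem_filter, mem_univ, true_and] at hi ⊢
      rw [eσ]
      exact lt_of_le_of_ne (not_lt.1 hi) (h' i)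
    · intro i _ j _ e
      exact σ.injective e
    · intro i hi
      simp only [mem_filter, mem_univ, true_and] at hi
      exact ⟨σ i, by simp [eσ, hi.le], eσ i⟩
    · intro i _
      rw [eσ]
  rw [← prod_filter_mul_prod_filter_not univ (fun i : Fin n => i < σ i), h2, h1, sq]
  congr 1
  exact prod_congr rfl fun i _ => hsymm _ _

theorem det_eq_pf_sq [CharP R 2] (n : ℕ) (B : ℕ → ℕ → R) (hsymm : ∀ i j, B i j = B j i)
    (hdiag : ∀ i, B i i = 0) :
    (Matrix.of fun i j : Fin n => B i j).det = pf (range n) B ^ 2 := by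
  classical
  rw [Matrix.det_apply]
  have hs : ∀ σ : Equiv.Perm (Fin n), Equiv.Perm.sign σ •
      ∏ i, (Matrix.of fun i j : Fin n => B i j) (σ i) i = ∏ i : Fin n, B (σ i) i := by
    intro σ
    rcases Int.units_eq_one_or (Equiv.Perm.sign σ) with e | e <;> simp [e, CharTwo.neg_eq]
  simp only [hs]
  rw [sum_perm_eq_sum_involutions]
  · rw [pf, CharTwo.sum_sq]
    symm
    rw [← sum_filter_add_sum_filter_not (univ.filter fun σ : Equiv.Perm (Fin n) => σ⁻¹ = σ)
      (fun σ => ∀ i, σ i ≠ i)]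
    rw [sum_eq_zero (s := filter (fun σ : Equiv.Perm (Fin n) => ¬ ∀ i, σ i ≠ i) _), add_zero]
    · symm
      refine sum_bij (fun σ _ => pairs σ) ?_ ?_ ?_ ?_
      · intro σ hσ
        simp only [mem_filter, mem_univ, true_and] at hσ
        exact mem_matchings.2 (isMatching_pairs hσ.1 hσ.2)
      · intro σ hσ τ hτ e
        simp only [mem_filter, mem_univ, true_and] at hσ hτ
        exact pairs_injective hσ.1 hσ.2 hτ.1 e
      · intro T hT
        obtain ⟨σ, h1, h2, h3⟩ := exists_pairs_eq (mem_matchings.1 hT)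
        exact ⟨σ, by simp [h1, h2], h3⟩
      · intro σ hσ
        simp only [mem_filter, mem_univ, true_and] at hσ
        exact prod_involution_eq_sq B hsymm hσ.1 hσ.2
    · intro σ hσ
      simp only [mem_filter, mem_univ, true_and, not_forall, not_not] at hσ
      obtain ⟨-, i, hi⟩ := hσ
      exact prod_eq_zero (mem_univ i) (by rw [hi, hdiag])
  · intro σ
    rw [← Equiv.prod_comp σ]
    refine prod_congr rfl fun i _ => ?_
    have : σ⁻¹ (σ i) = i := σ.symm_apply_apply i
    rw [this, hsymm]

end

end

section

open Finset

/-- A sum of powers of `q` with digit sum at least the number of its terms has no carries. -/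
theorem eq_of_sum_mul_pow_eq {q : ℕ} (hq : 2 ≤ q) (n : ℕ) (a ε : ℕ → ℕ)
    (hε : ∀ i, ε i ≤ 1)
    (h : ∑ i ∈ range n, a i * q ^ i = ∑ i ∈ range n, ε i * q ^ i)
    (hc : ∑ i ∈ range n, a i ≤ ∑ i ∈ range n, ε i) : ∀ i < n, a i = ε i := by
  induction n generalizing a ε with
  | zero => simp
  | succ n ih =>
    rw [sum_range_succ', sum_range_succ'] at h hc
    have hs : ∀ b : ℕ → ℕ, ∑ i ∈ range n, b (i + 1) * q ^ (i + 1) =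
        q * ∑ i ∈ range n, b (i + 1) * q ^ i := by
      intro b
      rw [mul_sum]
      exact sum_congr rfl fun i _ => by ring
    rw [hs, hs] at h
    simp only [pow_zero, mul_one] at h
    have h0 := hε 0
    obtain ⟨t, ht⟩ : ∃ t, a 0 = ε 0 + q * t := by
      have hmod : a 0 % q = ε 0 % q := by
        have := congrArg (· % q) h
        simpa [Nat.mul_add_mod] using this
      have hlt : ε 0 % q = ε 0 := Nat.mod_eq_of_lt (by omega)
      exact ⟨a 0 / q, by rw [← hlt, ← hmod, Nat.mod_add_div]⟩
    have h1 : ∑ i ∈ range n, a (i + 1) * q ^ i + t = ∑ i ∈ range n, ε (i + 1) * q ^ i := by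
      have : q * (∑ i ∈ range n, a (i + 1) * q ^ i + t) =
          q * ∑ i ∈ range n, ε (i + 1) * q ^ i := by
        rw [mul_add]
        omega
      exact Nat.eq_of_mul_eq_mul_left (by omega) this
    have hqt : 2 * t ≤ q * t := Nat.mul_le_mul_right t hq
    rcases Nat.eq_zero_or_pos n with rfl | hn
    · simp only [range_zero, sum_empty] at h1
      intro i hi
      have : i = 0 := by omega
      subst this
      rw [ht, show t = 0 by omega]
      simp
    · set a' : ℕ → ℕ := fun i => a (i + 1) + if i = 0 then t else 0 with ha'
      have e1 : ∑ i ∈ range n, a' i * q ^ i = ∑ i ∈ range n, ε (i + 1) * q ^ i := by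
        rw [← h1]
        simp only [ha', add_mul, sum_add_distrib, ite_mul, zero_mul]
        rw [sum_ite_eq' (range n) 0]
        simp [hn]
      have e2 : ∑ i ∈ range n, a' i = ∑ i ∈ range n, a (i + 1) + t := by
        simp only [ha', sum_add_distrib]
        rw [sum_ite_eq' (range n) 0]
        simp [hn]
      have key := ih a' (fun i => ε (i + 1)) (fun i => hε _) e1 (by rw [e2]; omega)
      have hsum : ∑ i ∈ range n, a' i = ∑ i ∈ range n, ε (i + 1) :=
        sum_congr rfl fun i hi => key i (mem_range.1 hi)
      have ht0 : t = 0 := by omega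
      intro i hi
      rcases i with _ | i
      · rw [ht, ht0]
        simp
      · have := key i (by omega)
        simp only [ha', ht0, ite_self, add_zero] at this
        exact this

theorem digits_geomSum {q : ℕ} (hq : 2 ≤ q) (n : ℕ) (R : Finset ℕ) (h : n = ∑ r ∈ R, q ^ r) :
    (∀ d ∈ Nat.digits q n, d ≤ 1) ∧ (Nat.digits q n).count 1 = #R := by
  induction n using Nat.strong_induction_on generalizing R with
  | _ n ih =>
    rcases Nat.eq_zero_or_pos n with rfl | hn
    · have : R = ∅ := by
        rw [eq_empty_iff_forall_notMem]
        intro r hr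
        have h0 := (sum_eq_zero_iff.1 h.symm) r hr
        exact absurd h0 (pow_ne_zero _ (by omega))
      simp [this]
    · set R' : Finset ℕ := (R.erase 0).image Nat.pred with hR'
      have hinj : Set.InjOn Nat.pred (R.erase 0 : Finset ℕ) := by
        intro a ha b hb e
        simp only [coe_erase, Set.mem_sdiff, Set.mem_singleton_iff] at ha hb
        have e : a - 1 = b - 1 := e
        omega
      have hs : ∑ r ∈ R.erase 0, q ^ r = q * ∑ r ∈ R', q ^ r := by
        rw [hR', sum_image hinj, mul_sum]
        refine sum_congr rfl fun r hr => ?_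
        have : r ≠ 0 := (mem_erase.1 hr).1
        rw [← pow_succ']
        congr 1
        exact (Nat.succ_pred this).symm
      have hcard : #R' = #(R.erase 0) := card_image_of_injOn hinj
      obtain ⟨ε, hε, hnε, hcε⟩ : ∃ ε, ε ≤ 1 ∧ n = ε + q * ∑ r ∈ R', q ^ r ∧ #R = ε + #R' := by
        by_cases h0 : 0 ∈ R
        · refine ⟨1, le_rfl, ?_, ?_⟩
          · rw [h, ← hs, ← add_sum_erase R _ h0, pow_zero]
          · rw [hcard, card_erase_of_mem h0]
            have := card_pos.2 ⟨0, h0⟩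
            omega
        · refine ⟨0, by omega, ?_, ?_⟩
          · rw [h, ← hs, erase_eq_of_notMem h0, zero_add]
          · rw [hcard, erase_eq_of_notMem h0, zero_add]
      have hdiv : n / q = ∑ r ∈ R', q ^ r := by
        rw [hnε, Nat.add_mul_div_left _ _ (by omega), Nat.div_eq_of_lt (by omega), zero_add]
      have hmod : n % q = ε := by
        rw [hnε, Nat.add_mul_mod_self_left, Nat.mod_eq_of_lt (by omega)]
      obtain ⟨i1, i2⟩ := ih (n / q) (Nat.div_lt_self hn (by omega)) R' hdiv
      rw [Nat.digits_def' (by omega) hn, hmod]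
      constructor
      · intro d hd
        rcases List.mem_cons.1 hd with rfl | hd
        · exact hε
        · exact i1 d hd
      · rw [List.count_cons, i2, hcε]
        interval_cases ε <;> simp [add_comm]

theorem exists_geomSum_of_digits {q : ℕ} (hq : 2 ≤ q) (n : ℕ)
    (h : ∀ d ∈ Nat.digits q n, d ≤ 1) : ∃ R : Finset ℕ, n = ∑ r ∈ R, q ^ r := by
  induction n using Nat.strong_induction_on with
  | _ n ih =>
    rcases Nat.eq_zero_or_pos n with rfl | hn
    · exact ⟨∅, by simp⟩
    · rw [Nat.digits_def' (by omega) hn] at h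
      obtain ⟨R, hR⟩ := ih (n / q) (Nat.div_lt_self hn (by omega))
        fun d hd => h d (List.mem_cons_of_mem _ hd)
      have h1 : n % q ≤ 1 := h _ List.mem_cons_self
      have h2 : ∑ r ∈ R.map ⟨Nat.succ, Nat.succ_injective⟩, q ^ r = q * (n / q) := by
        rw [sum_map, hR, mul_sum]
        exact sum_congr rfl fun r _ => by simp [pow_succ']
      have h3 := Nat.mod_add_div n q
      rcases Nat.le_one_iff_eq_zero_or_eq_one.1 h1 with h0 | h0
      · exact ⟨_, by rw [h2]; omega⟩
      · refine ⟨insert 0 (R.map ⟨Nat.succ, Nat.succ_injective⟩), ?_⟩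
        rw [sum_insert (by simp), h2, pow_zero]
        omega

/-- The exponents `r` for which `T` has a pair `(r, r + l + 1)`. -/
def rows (T : Finset (ℕ × ℕ)) (l : ℕ) : Finset ℕ :=
  (T.image Prod.fst).filter fun r => (r, r + l + 1) ∈ T

theorem mem_rows {T : Finset (ℕ × ℕ)} {l r : ℕ} : r ∈ rows T l ↔ (r, r + l + 1) ∈ T := by
  simp only [rows, mem_filter, mem_image, and_iff_right_iff_imp]
  exact fun h => ⟨_, h, rfl⟩

@[to_additive]
theorem prod_rows {M : Type*} [CommMonoid M] {N : ℕ} {T : Finset (ℕ × ℕ)}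
    (hT : ∀ p ∈ T, p.1 < p.2 ∧ p.2 - p.1 ≤ N) (f : ℕ × ℕ → M) :
    ∏ l : Fin N, ∏ r ∈ rows T l, f (r, r + l + 1) = ∏ p ∈ T, f p := by
  rw [prod_sigma']
  refine prod_bij (fun a _ => (a.2, a.2 + (a.1 : ℕ) + 1)) ?_ ?_ ?_ ?_
  · rintro ⟨l, r⟩ h
    exact mem_rows.1 (mem_sigma.1 h).2
  · rintro ⟨l, r⟩ _ ⟨l', r'⟩ _ e
    obtain ⟨e1, e2⟩ := Prod.ext_iff.1 e
    simp only at e1 e2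
    subst e1
    have : l = l' := Fin.ext (by omega)
    rw [this]
  · intro p hp
    obtain ⟨h1, h2⟩ := hT p hp
    have hpe : (p.1, p.1 + (p.2 - p.1 - 1) + 1) = p := Prod.ext rfl (by simp only; omega)
    refine ⟨⟨⟨p.2 - p.1 - 1, by omega⟩, p.1⟩, ?_, hpe⟩
    refine mem_sigma.2 ⟨mem_univ _, mem_rows.2 ?_⟩
    simp only
    rw [hpe]
    exact hp
  · intro _ _
    rfl

/-- The number of pairs of `T` containing `i`. -/
def pairCount (T : Finset (ℕ × ℕ)) (i : ℕ) : ℕ :=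
  #(T.filter fun p => p.1 = i ∨ p.2 = i)

theorem sum_pairs_eq {T : Finset (ℕ × ℕ)} {n : ℕ} (hT : ∀ p ∈ T, p.1 < p.2 ∧ p.2 < n)
    (f : ℕ → ℕ) : ∑ p ∈ T, (f p.1 + f p.2) = ∑ i ∈ range n, pairCount T i * f i := by
  simp only [pairCount, card_filter, sum_mul]
  rw [sum_comm]
  refine sum_congr rfl fun p hp => ?_
  obtain ⟨h1, h2⟩ := hT p hp
  have : ∀ i, (if p.1 = i ∨ p.2 = i then 1 else 0) * f i =
      (if p.1 = i then f i else 0) + if p.2 = i then f i else 0 := by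
    intro i
    split_ifs <;> omega
  simp only [this, sum_add_distrib, sum_ite_eq, mem_range]
  rw [if_pos (by omega), if_pos h2]

theorem isMatching_iff {I : Finset ℕ} {T : Finset (ℕ × ℕ)} (hT : ∀ p ∈ T, p.1 < p.2) :
    IsMatching I T ↔ ∀ i, pairCount T i = if i ∈ I then 1 else 0 := by
  have hone : ∀ i, pairCount T i = 1 ↔ ∃! p, p ∈ T ∧ (p.1 = i ∨ p.2 = i) := by
    intro i
    rw [pairCount, card_eq_one]
    constructor
    · rintro ⟨p, hp⟩
      have hm : ∀ p', p' ∈ T ∧ (p'.1 = i ∨ p'.2 = i) ↔ p' = p := by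
        intro p'
        rw [← mem_singleton (a := p), ← hp, mem_filter]
      exact ⟨p, (hm p).2 rfl, fun p' h => (hm p').1 h⟩
    · rintro ⟨p, hp, hu⟩
      refine ⟨p, ?_⟩
      ext p'
      rw [mem_filter, mem_singleton]
      exact ⟨hu p', fun h => h ▸ hp⟩
  have hzero : ∀ i, pairCount T i = 0 ↔ ∀ p ∈ T, ¬ (p.1 = i ∨ p.2 = i) := by
    intro i
    rw [pairCount, card_eq_zero, filter_eq_empty_iff]
  constructor
  · intro h i
    split_ifs with hi
    · exact (hone i).2 (h.2 i hi)
    · rw [hzero]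
      rintro p hp (rfl | rfl)
      · exact hi (h.1 p hp).2.1
      · exact hi (h.1 p hp).2.2
  · intro h
    have hmem : ∀ p ∈ T, ∀ i, p.1 = i ∨ p.2 = i → i ∈ I := by
      intro p hp i hpi
      by_contra hi
      have := h i
      rw [if_neg hi, hzero] at this
      exact this p hp hpi
    refine ⟨fun p hp => ⟨hT p hp, hmem p hp _ (Or.inl rfl), hmem p hp _ (Or.inr rfl)⟩, ?_⟩
    intro i hi
    rw [← hone, h, if_pos hi]

theorem IsMatching.sum_eq {I : Finset ℕ} {T : Finset (ℕ × ℕ)} (h : IsMatching I T) (f : ℕ → ℕ) :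
    ∑ p ∈ T, (f p.1 + f p.2) = ∑ i ∈ I, f i := by
  set n := I.sup id + 1 with hn
  have hI : ∀ i ∈ I, i < n := fun i hi => Nat.lt_succ_of_le (le_sup (f := id) hi)
  rw [sum_pairs_eq (n := n) fun p hp => ⟨(h.1 p hp).1, hI _ (h.1 p hp).2.2⟩]
  simp only [(isMatching_iff fun p hp => (h.1 p hp).1).1 h, ite_mul, one_mul, zero_mul]
  rw [← sum_filter]
  congr 1
  ext i
  simp only [mem_filter, mem_range]
  exact ⟨fun h => h.2, fun h => ⟨hI i h, h⟩⟩

theorem IsMatching.two_mul_card {I : Finset ℕ} {T : Finset (ℕ × ℕ)} (h : IsMatching I T) :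
    2 * #T = #I := by
  have := h.sum_eq fun _ => 1
  simp only [sum_const, smul_eq_mul, mul_one] at this
  omega

theorem isMatching_of_sum_pow {q : ℕ} (hq : 2 ≤ q) {I : Finset ℕ} {T : Finset (ℕ × ℕ)}
    (hT : ∀ p ∈ T, p.1 < p.2) (hcard : 2 * #T = #I)
    (h : ∑ p ∈ T, (q ^ p.1 + q ^ p.2) = ∑ i ∈ I, q ^ i) : IsMatching I T := by
  set n := max (I.sup id) (T.sup Prod.snd) + 1 with hn
  have hI : ∀ i ∈ I, i < n := fun i hi =>
    Nat.lt_succ_of_le (le_max_of_le_left (le_sup (f := id) hi))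
  have hTn : ∀ p ∈ T, p.1 < p.2 ∧ p.2 < n := fun p hp =>
    ⟨hT p hp, Nat.lt_succ_of_le (le_max_of_le_right (le_sup (f := Prod.snd) hp))⟩
  have hIf : ∀ f : ℕ → ℕ, ∑ i ∈ I, f i = ∑ i ∈ range n, (if i ∈ I then 1 else 0) * f i := by
    intro f
    simp only [ite_mul, one_mul, zero_mul]
    rw [← sum_filter]
    congr 1
    ext i
    simp only [mem_filter, mem_range]
    exact ⟨fun h => ⟨hI i h, h⟩, fun h => h.2⟩
  have key := eq_of_sum_mul_pow_eq hq n (pairCount T) (fun i => if i ∈ I then 1 else 0)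
    (fun i => by split_ifs <;> simp)
    (by rw [← sum_pairs_eq hTn (fun i => q ^ i), ← hIf (fun i => q ^ i), h])
    (by
      have h1 := sum_pairs_eq hTn fun _ => 1
      have h2 := hIf fun _ => 1
      simp only [sum_const, smul_eq_mul, mul_one] at h1 h2
      rw [← h1, ← h2]
      omega)
  rw [isMatching_iff hT]
  intro i
  by_cases hi : i < n
  · exact key i hi
  · rw [if_neg fun h => hi (hI i h), pairCount, card_eq_zero, filter_eq_empty_iff]
    intro p hp
    have := hTn p hp
    omega

theorem naturalSum_eq_pf (F : Type*) [Field F] [Fintype F] (m N k : ℕ) (I : Finset ℕ)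
    (hk : #I = 2 * k) (hN : ∀ i ∈ I, ∀ j ∈ I, i < j → j - i ≤ N) :
    naturalSum F m N (∑ i ∈ I, Fintype.card F ^ i) k =
      pf I fun i j => xi F m (j - i) ^ Fintype.card F ^ i := by
  classical
  have hq : 2 ≤ Fintype.card F := Fintype.one_lt_card
  set q := Fintype.card F with hqdef
  set expo : Finset (ℕ × ℕ) → Fin N → ℕ := fun T l => ∑ r ∈ rows T l, q ^ r with hexpo
  have hnat : ∀ T, IsNatural F (expo T) := fun T l => (digits_geomSum hq _ (rows T l) rfl).1
  have hmon : ∀ T : Finset (ℕ × ℕ), (∀ p ∈ T, p.1 < p.2 ∧ p.2 - p.1 ≤ N) →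
      monDegree F (expo T) = ∑ p ∈ T, (q ^ p.1 + q ^ p.2) := by
    intro T hT
    rw [← sum_rows hT, monDegree]
    refine sum_congr rfl fun l _ => ?_
    simp only [hexpo, sum_mul]
    refine sum_congr rfl fun r _ => ?_
    simp only [← hqdef, pow_add]
    ring
  have hdeg : ∀ T : Finset (ℕ × ℕ), (∀ p ∈ T, p.1 < p.2 ∧ p.2 - p.1 ≤ N) →
      naturalDegree F (expo T) = #T := by
    intro T hT
    rw [card_eq_sum_ones, ← sum_rows hT, naturalDegree]
    refine sum_congr rfl fun l _ => ?_
    rw [← card_eq_sum_ones]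
    exact (digits_geomSum hq _ (rows T l) rfl).2
  have hgood : ∀ T, IsMatching I T → ∀ p ∈ T, p.1 < p.2 ∧ p.2 - p.1 ≤ N := fun T h p hp =>
    ⟨(h.1 p hp).1, hN _ (h.1 p hp).2.1 _ (h.1 p hp).2.2 (h.1 p hp).1⟩
  symm
  rw [pf, naturalSum]
  refine sum_bij (fun T _ => expo T) ?_ ?_ ?_ ?_
  · intro T hT
    have hT := mem_matchings.1 hT
    have hg := hgood T hT
    have hm : monDegree F (expo T) = ∑ i ∈ I, q ^ i := by rw [hmon T hg, hT.sum_eq fun i => q ^ i]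
    refine mem_filter.2 ⟨Fintype.mem_piFinset.2 fun l => ?_, hnat T, hm, ?_⟩
    · rw [mem_range, Nat.lt_succ_iff, ← hm, monDegree]
      refine le_trans ?_ (single_le_sum (fun _ _ => Nat.zero_le _) (mem_univ l))
      exact Nat.le_mul_of_pos_right _ (by positivity)
    · rw [hdeg T hg]
      have := hT.two_mul_card
      omega
  · intro T hT T' hT' e
    have hg := hgood T (mem_matchings.1 hT)
    have hg' := hgood T' (mem_matchings.1 hT')
    have hr : ∀ l : Fin N, rows T l = rows T' l := fun l =>
      Finset.geomSum_injective hq (congrFun e l)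
    have key : ∀ {T₁ T₂ : Finset (ℕ × ℕ)}, (∀ p ∈ T₁, p.1 < p.2 ∧ p.2 - p.1 ≤ N) →
        (∀ l : Fin N, rows T₁ l = rows T₂ l) → T₁ ⊆ T₂ := by
      intro T₁ T₂ h₁ h p hp
      obtain ⟨h1, h2⟩ := h₁ p hp
      have hpe : (p.1, p.1 + (p.2 - p.1 - 1) + 1) = p := Prod.ext rfl (by simp only; omega)
      have := h ⟨p.2 - p.1 - 1, by omega⟩
      rw [← hpe, ← mem_rows] at hp ⊢
      exact this ▸ hp
    exact Subset.antisymm (key hg hr) (key hg' fun l => (hr l).symm)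
  · intro a ha
    obtain ⟨-, ha1, ha2, ha3⟩ := mem_filter.1 ha
    choose R hR using fun l => exists_geomSum_of_digits hq (a l) (ha1 l)
    set T : Finset (ℕ × ℕ) := univ.biUnion fun l : Fin N => (R l).image fun r => (r, r + l + 1)
      with hTdef
    have hT : ∀ p ∈ T, p.1 < p.2 ∧ p.2 - p.1 ≤ N := by
      intro p hp
      simp only [hTdef, mem_biUnion, mem_univ, true_and, mem_image] at hp
      obtain ⟨l, r, hr, rfl⟩ := hp
      simp only
      omega
    have hrows : ∀ l : Fin N, rows T l = R l := by
      intro l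
      ext r
      rw [mem_rows]
      simp only [hTdef, mem_biUnion, mem_univ, true_and, mem_image, Prod.mk.injEq]
      constructor
      · rintro ⟨l', r', hr', rfl, e⟩
        have : l' = l := Fin.ext (by omega)
        exact this ▸ hr'
      · intro hr
        exact ⟨l, r, hr, rfl, rfl⟩
    have he : expo T = a := by
      funext l
      simp only [hexpo, hrows]
      exact (hR l).symm
    refine ⟨T, mem_matchings.2 (isMatching_of_sum_pow hq (fun p hp => (hT p hp).1) ?_ ?_), he⟩
    · rw [← hdeg T hT, he, ha3, hk]
    · rw [← hmon T hT, he, ha2]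
  · intro T hT
    have hg := hgood T (mem_matchings.1 hT)
    rw [← prod_rows hg]
    refine prod_congr rfl fun l _ => ?_
    simp only [hexpo]
    rw [← prod_pow_eq_pow_sum]
    refine prod_congr rfl fun r _ => ?_
    simp only [show r + (l : ℕ) + 1 - r = (l : ℕ) + 1 by omega]

end

section

open Finset

section Moore

variable (F : Type*) [Field F] [Fintype F] {R : Type*} [CommRing R] [Algebra F R]

/-- The `q ^ k`-power map of an algebra over the field with `q` elements. -/
def frobPow (R : Type*) [CommRing R] [Algebra F R] (k : ℕ) : R →ₐ[F] R :=
  FiniteField.frobeniusAlgHom F R ^ k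

theorem frobPow_apply (k : ℕ) (r : R) : frobPow F R k r = r ^ Fintype.card F ^ k := by
  induction k with
  | zero => simp [frobPow]
  | succ k ih =>
    rw [frobPow, pow_succ', AlgHom.mul_apply, ← frobPow, ih, FiniteField.coe_frobeniusAlgHom,
      pow_succ, pow_mul]

theorem sum_smul_pow_card_pow {ι : Type*} (s : Finset ι) (c : ι → F) (a : ι → R) (k : ℕ) :
    (∑ i ∈ s, c i • a i) ^ Fintype.card F ^ k = ∑ i ∈ s, c i • a i ^ Fintype.card F ^ k := by
  simp only [← frobPow_apply F, map_sum, map_smul]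

theorem charP_two (F : Type*) [Field F] {R : Type*} [CommRing R] [Algebra F R] [Nontrivial R]
    [CharP F 2] : CharP R 2 :=
  charP_of_injective_algebraMap (algebraMap F R).injective 2

/-- The matrix of the powers `a_i ^ (q ^ e_k)`. -/
def moore {n n' : Type*} (a : n → R) (e : n' → ℕ) : Matrix n n' R :=
  Matrix.of fun i k => a i ^ Fintype.card F ^ e k

theorem prod_X_sub_C_of_roots [IsDomain R] {ι : Type*} [Fintype ι] (p : Polynomial R) (v : ι → R)
    (hv : Function.Injective v) (hroot : ∀ i, p.eval (v i) = 0)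
    (hdeg : p.natDegree ≤ Fintype.card ι) :
    p = Polynomial.C (p.coeff (Fintype.card ι)) *
      ∏ i, (Polynomial.X - Polynomial.C (v i)) := by
  have hm : (∏ i, (Polynomial.X - Polynomial.C (v i))).Monic :=
    Polynomial.monic_prod_of_monic _ _ fun i _ => Polynomial.monic_X_sub_C _
  have hd : (∏ i, (Polynomial.X - Polynomial.C (v i))).natDegree = Fintype.card ι := by
    rw [Polynomial.natDegree_prod_of_monic _ _ fun i _ => Polynomial.monic_X_sub_C _]
    simp
  refine Polynomial.eq_of_degree_sub_lt_of_eval_index_eq univ (v := v) hv.injOn ?_ ?_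
  · rw [card_univ, Polynomial.degree_lt_iff_coeff_zero]
    intro k hk
    rw [Polynomial.coeff_sub, Polynomial.coeff_C_mul]
    rcases hk.eq_or_lt with rfl | hk
    · have := hm.coeff_natDegree
      rw [hd] at this
      rw [this, mul_one, sub_self]
    · have h1 : p.coeff k = 0 := Polynomial.coeff_eq_zero_of_natDegree_lt (hdeg.trans_lt hk)
      have h2 : (∏ i, (Polynomial.X - Polynomial.C (v i))).coeff k = 0 :=
        Polynomial.coeff_eq_zero_of_natDegree_lt (by rwa [hd])
      rw [h1, h2, mul_zero, sub_zero]
  · intro i _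
    rw [hroot, Polynomial.eval_mul, Polynomial.eval_prod,
      prod_eq_zero (mem_univ i) (by simp), mul_zero]

/-- The maximal minors of the `n × (n + 1)` Moore matrix. -/
def mooreMinor {n : ℕ} (a : Fin n → R) (j : Fin (n + 1)) : R :=
  (moore F a fun k : Fin n => (j.succAbove k : ℕ)).det

theorem mooreMinor_last {n : ℕ} (a : Fin n → R) :
    mooreMinor F a (Fin.last n) = (moore F a fun k : Fin n => (k : ℕ)).det := by
  simp [mooreMinor]

theorem det_moore_succ [Nontrivial R] [CharP F 2] {n : ℕ} (a : Fin (n + 1) → R) :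
    (moore F a fun k : Fin (n + 1) => (k : ℕ)).det =
      ∑ j : Fin (n + 1), mooreMinor F (fun i : Fin n => a i.castSucc) j *
        a (Fin.last n) ^ Fintype.card F ^ (j : ℕ) := by
  have : CharP R 2 := charP_two F
  rw [Matrix.det_succ_row _ (Fin.last n)]
  refine sum_congr rfl fun j _ => ?_
  rw [CharTwo.neg_eq, one_pow, one_mul, mul_comm]
  congr 2
  ext i k
  simp [moore]

theorem det_moore_eq_zero [IsDomain R] {n : ℕ} (a : Fin (n + 1) → R) (c : Fin n → F)
    (h : a (Fin.last n) = ∑ i, c i • a i.castSucc) :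
    (moore F a fun k : Fin (n + 1) => (k : ℕ)).det = 0 := by
  rw [← Matrix.exists_vecMul_eq_zero_iff]
  refine ⟨Fin.snoc (fun i => algebraMap F R (c i)) (-1), ?_, ?_⟩
  · intro h0
    have := congrFun h0 (Fin.last n)
    simp at this
  · funext k
    simp only [Matrix.vecMul, dotProduct, Fin.sum_univ_castSucc, Fin.snoc_castSucc, Fin.snoc_last,
      moore, Matrix.of_apply, h, sum_smul_pow_card_pow, Pi.zero_apply]
    simp only [Algebra.smul_def]
    ring

theorem moore_polynomial [IsDomain R] [CharP F 2] {n : ℕ} (a : Fin n → R)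
    (ha : LinearIndependent F a) :
    ∑ j : Fin (n + 1), Polynomial.C (mooreMinor F a j) *
        Polynomial.X ^ Fintype.card F ^ (j : ℕ) =
      Polynomial.C (moore F a fun k : Fin n => (k : ℕ)).det *
        ∏ c : Fin n → F, (Polynomial.X - Polynomial.C (∑ i, c i • a i)) := by
  set p := ∑ j : Fin (n + 1), Polynomial.C (mooreMinor F a j) *
        Polynomial.X ^ Fintype.card F ^ (j : ℕ) with hp
  have hq : 1 < Fintype.card F := Fintype.one_lt_card
  have hcard : Fintype.card (Fin n → F) = Fintype.card F ^ n := by simp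
  have hroot : ∀ c : Fin n → F, p.eval (∑ i, c i • a i) = 0 := by
    intro c
    rw [hp, Polynomial.eval_finsetSum]
    have := det_moore_succ F (Fin.snoc a (∑ i, c i • a i) : Fin (n + 1) → R)
    rw [det_moore_eq_zero F _ c (by simp)] at this
    rw [this]
    refine sum_congr rfl fun j _ => ?_
    simp
  have hdeg : p.natDegree ≤ Fintype.card (Fin n → F) := by
    rw [hcard]
    refine Polynomial.natDegree_sum_le_of_forall_le _ _ fun j _ => ?_
    refine (Polynomial.natDegree_C_mul_X_pow_le _ _).trans ?_
    exact Nat.pow_le_pow_right hq.le (by omega)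
  have hinj : Function.Injective fun c : Fin n → F => ∑ i, c i • a i := by
    intro c c' h
    have h0 : ∑ i, (c i - c' i) • a i = 0 := by
      simp only [sub_smul, sum_sub_distrib]
      exact sub_eq_zero.2 h
    funext i
    exact sub_eq_zero.1 (Fintype.linearIndependent_iff.1 ha _ h0 i)
  have hcoeff : p.coeff (Fintype.card (Fin n → F)) =
      (moore F a fun k : Fin n => (k : ℕ)).det := by
    rw [hcard, hp, Polynomial.finsetSum_coeff, Fin.sum_univ_castSucc, sum_eq_zero, zero_add]
    · rw [Polynomial.coeff_C_mul, Fin.val_last, Polynomial.coeff_X_pow, if_pos rfl, mul_one,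
        mooreMinor_last]
    · intro j _
      rw [Polynomial.coeff_C_mul, Polynomial.coeff_X_pow, if_neg, mul_zero]
      intro e
      have := Nat.pow_right_injective hq e
      simp only [Fin.val_castSucc] at this
      omega
  rw [← hcoeff]
  exact prod_X_sub_C_of_roots p _ hinj hroot hdeg

theorem det_moore_mul_coeff [IsDomain R] [CharP F 2] {n : ℕ} (a : Fin n → R)
    (ha : LinearIndependent F a) (j : Fin (n + 1)) :
    (moore F a fun k : Fin n => (k : ℕ)).det *
      (∏ c : Fin n → F, (Polynomial.X - Polynomial.C (∑ i, c i • a i))).coeff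
        (Fintype.card F ^ (j : ℕ)) = mooreMinor F a j := by
  have hq : 1 < Fintype.card F := Fintype.one_lt_card
  rw [← Polynomial.coeff_C_mul, ← moore_polynomial F a ha, Polynomial.finsetSum_coeff,
    sum_eq_single j]
  · simp
  · intro i _ hij
    rw [Polynomial.coeff_C_mul, Polynomial.coeff_X_pow, if_neg, mul_zero]
    intro e
    exact hij (Fin.ext (Nat.pow_right_injective hq e).symm)
  · simp

theorem det_moore_mul_coeff_eq_zero [IsDomain R] [CharP F 2] {n : ℕ} (a : Fin n → R)
    (ha : LinearIndependent F a) (k : ℕ) (hk : ∀ j : Fin (n + 1), k ≠ Fintype.card F ^ (j : ℕ)) :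
    (moore F a fun k : Fin n => (k : ℕ)).det *
      (∏ c : Fin n → F, (Polynomial.X - Polynomial.C (∑ i, c i • a i))).coeff k = 0 := by
  rw [← Polynomial.coeff_C_mul, ← moore_polynomial F a ha, Polynomial.finsetSum_coeff]
  refine sum_eq_zero fun i _ => ?_
  rw [Polynomial.coeff_C_mul, Polynomial.coeff_X_pow, if_neg (hk i), mul_zero]

theorem det_moore_eq_prod [IsDomain R] [CharP F 2] (a : ℕ → R) (n : ℕ)
    (ha : LinearIndependent F fun i : Fin n => a i) :
    (moore F (fun i : Fin n => a i) fun k : Fin n => (k : ℕ)).det =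
      ∏ i ∈ range n, ∏ c : Fin i → F, (a i + ∑ j : Fin i, c j • a j) := by
  have : CharP R 2 := charP_two F
  induction n with
  | zero => simp
  | succ n ih =>
    have ha' : LinearIndependent F fun i : Fin n => a i :=
      ha.comp Fin.castSucc (Fin.castSucc_injective n)
    rw [prod_range_succ, ← ih ha', det_moore_succ]
    have := congrArg (Polynomial.eval (a n)) (moore_polynomial F (fun i : Fin n => a i) ha')
    rw [Polynomial.eval_finsetSum, Polynomial.eval_mul, Polynomial.eval_C,
      Polynomial.eval_prod] at this
    simp only [Polynomial.eval_sub, Polynomial.eval_mul, Polynomial.eval_pow, Polynomial.eval_X,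
      Polynomial.eval_C] at this
    simp only [CharTwo.sub_eq_add] at this
    simpa using this

theorem det_moore_ne_zero [IsDomain R] [CharP F 2] (a : ℕ → R) (n : ℕ)
    (ha : LinearIndependent F fun i : Fin n => a i) :
    (moore F (fun i : Fin n => a i) fun k : Fin n => (k : ℕ)).det ≠ 0 := by
  rw [det_moore_eq_prod F a n ha, prod_ne_zero_iff]
  intro i hi
  rw [prod_ne_zero_iff]
  intro c _ h0
  have hi := mem_range.1 hi
  have hsum : ∀ f : ℕ → R, ∑ j : Fin i, c j • f j =
      ∑ j ∈ range i, (if h : j < i then c ⟨j, h⟩ else 0) • f j := by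
    intro f
    rw [← Fin.sum_univ_eq_sum_range]
    simp
  set b : ℕ → F := fun j => if h : j < i then c ⟨j, h⟩ else if j = i then 1 else 0 with hb
  have h1 : ∑ j : Fin n, b j • a j = 0 := by
    rw [Fin.sum_univ_eq_sum_range (fun j => b j • a j),
      ← sum_subset (range_subset_range.2 (by omega : i + 1 ≤ n)), sum_range_succ, ← h0, hsum,
      add_comm]
    · congr 1
      · simp [hb]
      · refine sum_congr rfl fun j hj => ?_
        have := mem_range.1 hj
        simp [hb, this]
    · intro j _ hj
      have : ¬ j < i + 1 := fun h => hj (mem_range.2 h)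
      simp only [hb]
      rw [dif_neg (by omega), if_neg (by omega), zero_smul]
  have h2 := Fintype.linearIndependent_iff.1 ha _ h1 ⟨i, hi⟩
  simp [hb] at h2

end Moore

section Variables

open MvPolynomial

variable (F : Type*) [Field F] [Fintype F] (m : ℕ)

/-- The variables in the order `x_1, …, x_m, y_m, …, y_1`. -/
def revOrder : Fin (2 * m) ≃ Fin m ⊕ Fin m where
  toFun i := if h : (i : ℕ) < m then Sum.inr ⟨i, h⟩ else Sum.inl ⟨2 * m - 1 - i, by omega⟩
  invFun := Sum.elim (fun j => ⟨2 * m - 1 - j, by omega⟩) fun j => ⟨j, by omega⟩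
  left_inv := by
    intro i
    by_cases h : (i : ℕ) < m
    · simp [h]
    · simp only [h, dite_false, Sum.elim_inl, Fin.ext_iff]
      omega
  right_inv := by
    rintro (j | j)
    · have : ¬ (2 * m - 1 - (j : ℕ) < m) := by omega
      refine (dif_neg this).trans (congrArg Sum.inl (Fin.ext ?_))
      simp only [Sum.elim_inl]
      omega
    · simp

theorem pos_revOrder (i : Fin (2 * m)) : pos m (revOrder m i) = 2 * m - 1 - i := by
  by_cases h : (i : ℕ) < m <;> simp [revOrder, pos, h]

/-- The variables as a sequence, in the order `x_1, …, x_m, y_m, …, y_1`. -/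
def varSeq (k : ℕ) : S F m := if h : k < 2 * m then X (revOrder m ⟨k, h⟩) else 0

theorem varSeq_fin (i : Fin (2 * m)) : varSeq F m i = X (revOrder m i) := by
  simp [varSeq]

theorem linearIndependent_varSeq : LinearIndependent F fun i : Fin (2 * m) => varSeq F m i := by
  simp only [varSeq_fin]
  exact (linearIndependent_X (Fin m ⊕ Fin m) F).comp _ (revOrder m).injective

theorem linForm_eq (c : Fin m ⊕ Fin m → F) :
    linForm F m c = ∑ i : Fin (2 * m), c (revOrder m i) • varSeq F m i := by
  rw [linForm, ← (revOrder m).sum_comp]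
  refine sum_congr rfl fun i _ => ?_
  rw [varSeq_fin, smul_eq_C_mul]

theorem orbitProd_revOrder (i : Fin (2 * m)) :
    orbitProd F m (revOrder m i) =
      ∏ c : Fin i → F, (varSeq F m i + ∑ j : Fin i, c j • varSeq F m j) := by
  classical
  have hi := i.2
  rw [orbitProd]
  refine prod_bij (fun c _ (j : Fin i) => c (revOrder m ⟨j, by omega⟩)) ?_ ?_ ?_ ?_
  · intro c _
    exact mem_univ _
  · intro c hc c' hc' h
    simp only [mem_filter, mem_univ, true_and] at hc hc'
    funext k
    obtain ⟨k, rfl⟩ := (revOrder m).surjective k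
    rcases lt_trichotomy k i with hk | rfl | hk
    · exact congrFun h ⟨k, hk⟩
    · rw [hc.1, hc'.1]
    · have hp : pos m (revOrder m k) < pos m (revOrder m i) := by
        rw [pos_revOrder, pos_revOrder]
        have : (i : ℕ) < k := hk
        omega
      rw [hc.2 _ hp, hc'.2 _ hp]
  · intro b _
    refine ⟨fun k => if h : ((revOrder m).symm k : ℕ) < i then b ⟨_, h⟩ else
      if (revOrder m).symm k = i then 1 else 0, ?_, ?_⟩
    · simp only [mem_filter, mem_univ, true_and, Equiv.symm_apply_apply, lt_irrefl, dite_false,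
        if_true]
      intro k hk
      obtain ⟨k, rfl⟩ := (revOrder m).surjective k
      rw [pos_revOrder, pos_revOrder] at hk
      rw [Equiv.symm_apply_apply, dif_neg (by omega), if_neg]
      rintro rfl
      omega
    · funext j
      simp
  · intro c hc
    simp only [mem_filter, mem_univ, true_and] at hc
    set f : ℕ → S F m := fun k =>
      (if h : k < 2 * m then c (revOrder m ⟨k, h⟩) else 0) • varSeq F m k with hf
    have h1 : linForm F m c = ∑ k ∈ range (2 * m), f k := by
      rw [linForm_eq, ← Fin.sum_univ_eq_sum_range]
      simp [hf]
    have h2 : ∑ j : Fin i, c (revOrder m ⟨j, by omega⟩) • varSeq F m j = ∑ k ∈ range i, f k := by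
      rw [← Fin.sum_univ_eq_sum_range]
      refine sum_congr rfl fun j _ => ?_
      simp only [hf]
      rw [dif_pos]
    rw [h1, h2, ← sum_subset (range_subset_range.2 (by omega : (i : ℕ) + 1 ≤ 2 * m)),
      sum_range_succ, add_comm]
    · congr 1
      simp [hf, hc.1]
    · intro k hk hk'
      have hk := mem_range.1 hk
      have : ¬ k < (i : ℕ) + 1 := fun h => hk' (mem_range.2 h)
      simp only [hf]
      rw [dif_pos hk, hc.2, zero_smul]
      rw [pos_revOrder, pos_revOrder]
      simp only
      omega

theorem u_eq_det [CharP F 2] :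
    u F m = (moore F (fun i : Fin (2 * m) => varSeq F m i) fun k : Fin (2 * m) => (k : ℕ)).det := by
  rw [det_moore_eq_prod F _ _ (linearIndependent_varSeq F m), u, ← (revOrder m).prod_comp,
    ← Fin.prod_univ_eq_prod_range (fun i => ∏ c : Fin i → F,
      (varSeq F m i + ∑ j : Fin i, c j • varSeq F m j))]
  exact prod_congr rfl fun i _ => orbitProd_revOrder F m i

theorem u_ne_zero [CharP F 2] : u F m ≠ 0 := by
  rw [u_eq_det]
  exact det_moore_ne_zero F _ _ (linearIndependent_varSeq F m)

/-- The product of `t - v` over all linear forms `v`. -/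
def dicksonPoly : Polynomial (S F m) :=
  ∏ c : Fin (2 * m) → F, (Polynomial.X - Polynomial.C (∑ i, c i • varSeq F m i))

theorem dicksonPoly_eq :
    dicksonPoly F m = ∏ c : Fin m ⊕ Fin m → F, (Polynomial.X - Polynomial.C (linForm F m c)) := by
  rw [dicksonPoly, ← (Equiv.arrowCongr (revOrder m) (Equiv.refl F)).prod_comp]
  refine prod_congr rfl fun c _ => ?_
  rw [linForm_eq]
  simp [Equiv.arrowCongr]

theorem dickson_eq_coeff (i : ℕ) :
    dickson F m i = (dicksonPoly F m).coeff (Fintype.card F ^ (2 * m - i)) := by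
  classical
  have hq : 0 < Fintype.card F ^ (2 * m - i) := pow_pos Fintype.card_pos _
  rw [dickson, dicksonPoly_eq]
  have h : (univ : Finset (Fin m ⊕ Fin m → F)).filter (fun c => c ≠ 0) = univ.erase 0 := by
    ext c
    simp
  have h0 : linForm F m 0 = 0 := by simp [linForm]
  rw [← mul_prod_erase univ _ (mem_univ (0 : Fin m ⊕ Fin m → F)), h0, map_zero, sub_zero]
  obtain ⟨k, hk⟩ := Nat.exists_eq_succ_of_ne_zero hq.ne'
  rw [hk, Polynomial.coeff_X_mul]
  simp only [h, Nat.succ_sub_one]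

theorem u_mul_coeff [CharP F 2] (j : Fin (2 * m + 1)) :
    u F m * (dicksonPoly F m).coeff (Fintype.card F ^ (j : ℕ)) =
      mooreMinor F (fun i : Fin (2 * m) => varSeq F m i) j := by
  rw [u_eq_det, dicksonPoly, det_moore_mul_coeff F _ (linearIndependent_varSeq F m)]

theorem dicksonPoly_coeff_eq_zero [CharP F 2] (k : ℕ)
    (hk : ∀ j : Fin (2 * m + 1), k ≠ Fintype.card F ^ (j : ℕ)) :
    (dicksonPoly F m).coeff k = 0 := by
  have := det_moore_mul_coeff_eq_zero F _ (linearIndependent_varSeq F m) k hk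
  rw [← u_eq_det] at this
  exact (mul_eq_zero.1 this).resolve_left (u_ne_zero F m)

end Variables

end

section

open Finset MvPolynomial

section Pairing

variable {m : ℕ} {R : Type*} [CommRing R]

/-- The standard symplectic form. -/
def pairing (a b : Fin m ⊕ Fin m → R) : R := ∑ i, a i * b i.swap

theorem pairing_comm (a b : Fin m ⊕ Fin m → R) : pairing a b = pairing b a := by
  rw [pairing, pairing, ← (Equiv.sumComm (Fin m) (Fin m)).sum_comp]
  refine sum_congr rfl fun i _ => ?_
  rw [Equiv.sumComm_apply, Sum.swap_swap, mul_comm]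

theorem pairing_self [CharP R 2] (a : Fin m ⊕ Fin m → R) : pairing a a = 0 := by
  rw [pairing, Fintype.sum_sum_type, ← sum_add_distrib]
  refine sum_eq_zero fun i _ => ?_
  rw [Sum.swap_inl, Sum.swap_inr, mul_comm, CharTwo.add_self_eq_zero]

theorem pairing_single [DecidableEq (Fin m ⊕ Fin m)] (v : Fin m ⊕ Fin m)
    (a : Fin m ⊕ Fin m → R) : pairing (Pi.single v 1) a = a v.swap := by
  rw [pairing, sum_eq_single v]
  · simp
  · intro i _ hi
    rw [Pi.single_eq_of_ne hi, zero_mul]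
  · simp

theorem det_permute_charTwo [CharP R 2] {n : Type*} [Fintype n] [DecidableEq n]
    (σ : Equiv.Perm n) (A : Matrix n n R) : (A.submatrix σ id).det = A.det := by
  rw [Matrix.det_permute]
  rcases Int.units_eq_one_or (Equiv.Perm.sign σ) with e | e <;> simp [e, CharTwo.neg_eq]

theorem det_permute_charTwo' [CharP R 2] {n : Type*} [Fintype n] [DecidableEq n]
    (σ : Equiv.Perm n) (A : Matrix n n R) : (A.submatrix id σ).det = A.det := by
  rw [Matrix.det_permute']
  rcases Int.units_eq_one_or (Equiv.Perm.sign σ) with e | e <;> simp [e, CharTwo.neg_eq]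

/-- The matrix with columns `t 0, …, t (2 m - 1)`. -/
def colMatrix (t : ℕ → Fin m ⊕ Fin m → R) : Matrix (Fin (2 * m)) (Fin (2 * m)) R :=
  Matrix.of fun i k => t k (revOrder m i)

theorem det_colMatrix [IsDomain R] [CharP R 2] (t : ℕ → Fin m ⊕ Fin m → R) :
    (colMatrix t).det = pf (range (2 * m)) fun i j => pairing (t i) (t j) := by
  apply frobenius_inj R 2
  rw [frobenius_def, frobenius_def, ← det_eq_pf_sq (2 * m) (fun i j => pairing (t i) (t j))
    (fun i j => pairing_comm _ _) (fun i => pairing_self _)]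
  set π : Equiv.Perm (Fin (2 * m)) :=
    ((revOrder m).trans (Equiv.sumComm _ _)).trans (revOrder m).symm with hπ
  have : (Matrix.of fun i j : Fin (2 * m) => pairing (t i) (t j)) =
      (colMatrix t).transpose * (colMatrix t).submatrix π id := by
    ext i j
    rw [Matrix.mul_apply, Matrix.of_apply, pairing, ← (revOrder m).sum_comp]
    refine sum_congr rfl fun k _ => ?_
    simp [colMatrix, hπ]
  rw [this, Matrix.det_mul, Matrix.det_transpose, det_permute_charTwo, sq]

end Pairing

section CharTwo

variable {F : Type*} [Field F] [Fintype F] [CharP F 2] {σ : Type*}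

theorem exists_eq_sq (c : F) : ∃ r : F, c = r ^ 2 := by
  obtain ⟨r, hr⟩ := FiniteField.isSquare_of_char_two (ringChar.eq F 2) c
  exact ⟨r, by rw [hr, sq]⟩

/-- A polynomial with vanishing partial derivatives over a finite field of characteristic two is
a square. -/
theorem exists_sq_of_pderiv_eq_zero (f : MvPolynomial σ F) (h : ∀ i, pderiv i f = 0) :
    ∃ g, f = g ^ 2 := by
  classical
  have heven : ∀ d ∈ f.support, ∀ i, 2 ∣ d i := by
    intro d hd i
    rcases Nat.eq_zero_or_pos (d i) with h0 | h0
    · simp [h0]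
    · have hc := congrArg (coeff (d - Finsupp.single i 1)) (h i)
      have hle : Finsupp.single i 1 ≤ d := Finsupp.single_le_iff.2 h0
      rw [coeff_pderiv, coeff_zero, tsub_add_cancel_of_le hle] at hc
      have h1 := (mul_eq_zero.1 hc).resolve_left (mem_support_iff.1 hd)
      rw [Finsupp.coe_tsub, Pi.sub_apply, Finsupp.single_eq_same, ← Nat.cast_succ,
        CharP.cast_eq_zero_iff F 2, Nat.succ_eq_add_one, Nat.sub_add_cancel h0] at h1
      exact h1
  choose s hs using exists_eq_sq (F := F)
  refine ⟨∑ d ∈ f.support, monomial (d.mapRange (· / 2) rfl) (s (coeff d f)), ?_⟩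
  have : CharP (MvPolynomial σ F) 2 := charP_two F
  rw [CharTwo.sum_sq]
  conv_lhs => rw [f.as_sum]
  refine sum_congr rfl fun d hd => ?_
  rw [monomial_pow, ← hs]
  congr 2
  ext i
  have := heven d hd i
  simp only [Finsupp.smul_apply, Finsupp.mapRange_apply, smul_eq_mul]
  omega

theorem totalDegree_pderiv_lt (p : MvPolynomial σ F) (i : σ) (h : pderiv i p ≠ 0) :
    (pderiv i p).totalDegree < p.totalDegree := by
  classical
  have key : ∀ d ∈ (pderiv i p).support, (d.sum fun _ e => e) < p.totalDegree := by
    intro d hd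
    rw [mem_support_iff, coeff_pderiv] at hd
    have := le_totalDegree (mem_support_iff.2 (left_ne_zero_of_mul hd))
    rw [Finsupp.sum_add_index' (fun _ => rfl) (fun _ _ _ => rfl), Finsupp.sum_single_index rfl] at this
    omega
  obtain ⟨d, hd⟩ := support_nonempty.2 h
  rw [totalDegree, Finset.sup_lt_iff (lt_of_le_of_lt (Nat.zero_le _) (key d hd))]
  exact key

theorem pderiv_aeval {τ : Type*} [Fintype τ] (x : τ → MvPolynomial σ F) (v : σ)
    (p : MvPolynomial τ F) :
    pderiv v (aeval x p) = ∑ i, aeval x (pderiv i p) * pderiv v (x i) := by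
  classical
  induction p using MvPolynomial.induction_on with
  | C a => simp
  | add p q hp hq => simp only [map_add, hp, hq, add_mul, sum_add_distrib]
  | mul_X p j hp =>
    simp only [map_mul, aeval_X, pderiv_mul, hp, map_add, add_mul, sum_add_distrib, sum_mul]
    congr 1
    · exact sum_congr rfl fun i _ => by ring
    · rw [sum_eq_single j]
      · simp
      · intro i _ hi
        simp [pderiv_X_of_ne hi.symm]
      · simp

/-- The Jacobian criterion: a family of polynomials with nonsingular Jacobian matrix is
algebraically independent. -/
theorem algebraicIndependent_of_jacobian {τ : Type*} [Fintype τ] (x : τ → MvPolynomial σ F)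
    (hx : ∀ c : τ → MvPolynomial σ F, (∀ v, ∑ i, c i * pderiv v (x i) = 0) → c = 0) :
    AlgebraicIndependent F x := by
  rw [algebraicIndependent_iff]
  intro p
  induction hn : p.totalDegree using Nat.strong_induction_on generalizing p with
  | _ n ih =>
    subst hn
    intro hp
    have hd : ∀ i, pderiv i p = 0 := by
      have h0 := hx (fun i => aeval x (pderiv i p)) fun v => by
        rw [← pderiv_aeval, hp, map_zero]
      intro i
      by_contra hne
      exact hne (ih _ (totalDegree_pderiv_lt p i hne) _ rfl (congrFun h0 i))
    obtain ⟨g, rfl⟩ := exists_sq_of_pderiv_eq_zero p hd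
    have hg : aeval x g = 0 := by
      rw [map_pow] at hp
      exact pow_eq_zero_iff two_ne_zero |>.1 hp
    by_cases hg0 : g.totalDegree = 0
    · rw [totalDegree_eq_zero_iff_eq_C] at hg0
      rw [hg0] at hg ⊢
      rw [aeval_C, algebraMap_eq, C_eq_zero] at hg
      simp [hg]
    · by_contra hne
      have hgne : g ≠ 0 := by
        rintro rfl
        simp at hne
      refine hgne (ih g.totalDegree ?_ g rfl hg)
      rw [sq, totalDegree_mul_of_isDomain hgne hgne]
      omega

end CharTwo

section Xi

variable (F : Type*) [Field F] [Fintype F] (m : ℕ)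

/-- The vector of the `q ^ k`-th powers of the variables. -/
def powVec (k : ℕ) (i : Fin m ⊕ Fin m) : S F m := X i ^ Fintype.card F ^ k

theorem xi_eq_pairing (k : ℕ) : xi F m k = pairing (powVec F m 0) (powVec F m k) := by
  rw [pairing, Fintype.sum_sum_type, xi, sum_add_distrib, add_comm]
  simp [powVec, x, y]

theorem pairing_powVec {i j : ℕ} (h : i ≤ j) :
    pairing (powVec F m i) (powVec F m j) = xi F m (j - i) ^ Fintype.card F ^ i := by
  rw [← frobPow_apply, xi_eq_pairing, pairing, pairing, map_sum]
  refine sum_congr rfl fun v _ => ?_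
  rw [map_mul, frobPow_apply, frobPow_apply]
  simp only [powVec, ← pow_mul, ← pow_add, pow_zero, one_mul, Nat.sub_add_cancel h]

theorem pf_powVec (I : Finset ℕ) : (pf I fun i j => pairing (powVec F m i) (powVec F m j)) =
    pf I fun i j => xi F m (j - i) ^ Fintype.card F ^ i :=
  pf_congr fun _ _ _ _ h => pairing_powVec F m h.le

theorem moore_varSeq (e : ℕ → ℕ) :
    (moore F (fun i : Fin (2 * m) => varSeq F m i) fun k : Fin (2 * m) => e k) =
      colMatrix fun k => powVec F m (e k) := by
  ext i k
  simp only [moore, colMatrix, powVec, Matrix.of_apply, varSeq_fin]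

theorem u_eq_det_colMatrix [CharP F 2] : u F m = (colMatrix (powVec F m)).det := by
  rw [u_eq_det, moore_varSeq F m fun k => k]

theorem u_eq_pf [CharP F 2] :
    u F m = pf (range (2 * m)) fun i j => xi F m (j - i) ^ Fintype.card F ^ i := by
  have : CharP (S F m) 2 := charP_two F
  rw [u_eq_det_colMatrix, det_colMatrix, pf_powVec]

theorem det_powVec_succ [CharP F 2] :
    (colMatrix fun k => powVec F m (k + 1)).det = u F m ^ Fintype.card F := by
  have h := frobPow_apply F (R := S F m) 1 (u F m)
  rw [pow_one] at h
  rw [← h, u_eq_det_colMatrix, AlgHom.map_det]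
  congr 1
  ext1 i k
  rw [AlgHom.mapMatrix_apply, Matrix.map_apply, frobPow_apply]
  simp only [colMatrix, powVec, Matrix.of_apply, ← pow_mul, ← pow_add]

theorem pderiv_pow_card_pow {σ : Type*} (v : σ) (f : MvPolynomial σ F) {k : ℕ} (hk : k ≠ 0) :
    pderiv v (f ^ Fintype.card F ^ k) = 0 := by
  rw [pderiv_pow, Nat.cast_pow]
  have : ((Fintype.card F : ℕ) : MvPolynomial σ F) = 0 := by
    rw [← map_natCast (C : F →+* MvPolynomial σ F), FiniteField.cast_card_eq_zero, map_zero]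
  rw [this, zero_pow hk, zero_mul, zero_mul]

theorem pderiv_xi (v : Fin m ⊕ Fin m) {k : ℕ} (hk : k ≠ 0) :
    pderiv v (xi F m k) = powVec F m k v.swap := by
  classical
  rw [xi_eq_pairing, pairing, map_sum, sum_eq_single v]
  · simp [powVec, pderiv_pow_card_pow F v _ hk]
  · intro i _ hi
    simp [powVec, pderiv_pow_card_pow F v _ hk, pderiv_X_of_ne hi]
  · simp

theorem algebraicIndependent_xi_full [CharP F 2] :
    AlgebraicIndependent F fun i : Fin (2 * m) => xi F m (i + 1) := by
  apply algebraicIndependent_of_jacobian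
  intro c hc
  refine Matrix.eq_zero_of_mulVec_eq_zero (M := colMatrix fun k => powVec F m (k + 1)) ?_ ?_
  · rw [det_powVec_succ]
    exact pow_ne_zero _ (u_ne_zero F m)
  · funext v
    rw [Pi.zero_apply, ← hc (revOrder m v).swap, Matrix.mulVec, dotProduct]
    refine sum_congr rfl fun i _ => ?_
    rw [pderiv_xi F m _ (Nat.succ_ne_zero _), Sum.swap_swap, mul_comm]
    rfl

theorem algebraicIndependent_xi [CharP F 2] {N : ℕ} (hN : N ≤ 2 * m) :
    AlgebraicIndependent F fun i : Fin N => xi F m (i + 1) :=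
  (algebraicIndependent_xi_full F m).comp (Fin.castLE hN) (Fin.castLE_injective hN)

/-- The Pfaffian expressing `u_{m-1}` through `ξ_1, …, ξ_{2m-3}`, evaluated in `S_m`. -/
def uPrev : S F m :=
  pf (range (2 * m - 2)) fun i j => xi F m (j - i) ^ Fintype.card F ^ i

/-- The same Pfaffian as a polynomial in indeterminates. -/
def uPrevPoly : MvPolynomial (Fin (2 * m - 3)) F :=
  pf (range (2 * m - 2)) fun i j =>
    if h : j - i - 1 < 2 * m - 3 then X ⟨j - i - 1, h⟩ ^ Fintype.card F ^ i else 0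

theorem aeval_uPrevPoly (n : ℕ) :
    aeval (fun i : Fin (2 * m - 3) => xi F n ((i : ℕ) + 1)) (uPrevPoly F m) =
      pf (range (2 * m - 2)) fun i j => xi F n (j - i) ^ Fintype.card F ^ i := by
  rw [uPrevPoly, ← AlgHom.coe_toRingHom, map_pf]
  refine pf_congr fun i hi j hj hij => ?_
  have hj := mem_range.1 hj
  rw [dif_pos (by omega), AlgHom.coe_toRingHom, map_pow, aeval_X]
  simp only
  rw [Nat.sub_add_cancel (by omega)]

theorem aeval_uPrevPoly_pred [CharP F 2] :
    aeval (fun i : Fin (2 * m - 3) => xi F (m - 1) ((i : ℕ) + 1)) (uPrevPoly F m) =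
      u F (m - 1) := by
  rw [aeval_uPrevPoly, u_eq_pf, show 2 * (m - 1) = 2 * m - 2 by omega]

theorem isUPrev_iff [CharP F 2] (w : S F m) : IsUPrev F m w ↔ w = uPrev F m := by
  have hu := aeval_uPrevPoly_pred F m
  constructor
  · rintro ⟨P, hP, rfl⟩
    have : P = uPrevPoly F m :=
      algebraicIndependent_xi F (m - 1) (N := 2 * m - 3) (by omega) (hP.trans hu.symm)
    rw [this, aeval_uPrevPoly, uPrev]
  · rintro rfl
    exact ⟨uPrevPoly F m, hu, (aeval_uPrevPoly F m m).symm⟩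

theorem uPrev_ne_zero [CharP F 2] : uPrev F m ≠ 0 := by
  intro h
  rw [uPrev, ← aeval_uPrevPoly F m m] at h
  have h0 : uPrevPoly F m = 0 :=
    algebraicIndependent_iff.1 (algebraicIndependent_xi F m (N := 2 * m - 3) (by omega)) _ h
  have hu := aeval_uPrevPoly_pred F m
  rw [h0, map_zero] at hu
  exact u_ne_zero F (m - 1) hu.symm

end Xi

end

section

open Finset MvPolynomial

section Determinants

variable {R : Type*} [CommRing R] {n : Type*} [Fintype n] [DecidableEq n]

theorem det_updateCol_eq_sum (A : Matrix n n R) (k : n) (b : n → R) :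
    (A.updateCol k b).det = ∑ i, b i * (A.updateCol k (Pi.single i 1)).det := by
  simp only [← Matrix.cramer_apply]
  conv_lhs => rw [pi_eq_sum_univ' b, map_sum, Finset.sum_apply]
  refine sum_congr rfl fun i _ => ?_
  rw [map_smul, Pi.smul_apply, smul_eq_mul]

/-- The three term Plücker relation. -/
theorem det_updateCol_mul (A : Matrix n n R) {i j : n} (hij : i ≠ j)
    (a b c d : n → R) :
    ((A.updateCol i c).updateCol j d).det * ((A.updateCol i a).updateCol j b).det =
      ((A.updateCol i b).updateCol j d).det * ((A.updateCol i a).updateCol j c).det +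
        ((A.updateCol i c).updateCol j b).det * ((A.updateCol i a).updateCol j d).det := by
  set P := (A.updateCol i c).updateCol j d with hP
  have h := Matrix.mulVec_cramer P b
  have hsum : P.mulVec (P.cramer b) = ∑ k, P.cramer b k • fun r => P r k := by
    funext r
    simp [Matrix.mulVec, dotProduct, mul_comm]
  rw [hsum] at h
  have h' := congrArg (fun v => (A.updateCol i a).cramer v j) h
  simp only [map_sum, map_smul, Finset.sum_apply, Pi.smul_apply, smul_eq_mul] at h'
  simp only [Matrix.cramer_apply] at h'
  rw [← h', ← sum_subset (subset_univ {i, j}), sum_pair hij]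
  · congr 1
    · congr 1
      · rw [hP, Matrix.updateCol_comm _ hij, Matrix.updateCol_idem, Matrix.updateCol_comm _ hij.symm]
      · congr 2
        funext r
        simp [hP, hij]
    · congr 1
      · rw [hP, Matrix.updateCol_idem]
      · congr 2
        funext r
        simp [hP]
  · intro k _ hk
    simp only [mem_insert, mem_singleton, not_or] at hk
    have h0 : ((A.updateCol i a).updateCol j fun r => P r k).det = 0 :=
      Matrix.det_zero_of_column_eq hk.2 fun r => by
        simp [hP, hk.1, hk.2]
    rw [h0, mul_zero]

theorem det_eq_of_columns [CharP R 2] {A B : Matrix n n R} (f : n → n)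
    (hf : Function.Injective f) (h : ∀ i k, A i k = B i (f k)) : A.det = B.det := by
  rw [← det_permute_charTwo' (Equiv.ofBijective f (Finite.injective_iff_bijective.1 hf)) B]
  congr 1
  ext i k
  exact h i k

theorem derivation_prod_eq_zero {K : Type*} [CommRing K] [Algebra K R] (D : Derivation K R R)
    {ι : Type*} (s : Finset ι) (f : ι → R) (h : ∀ i ∈ s, D (f i) = 0) : D (∏ i ∈ s, f i) = 0 := by
  refine prod_induction f (fun r => D r = 0) ?_ (by simp) h
  intro a b ha hb
  rw [D.leibniz, ha, hb, smul_zero, smul_zero, add_zero]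

theorem derivation_det_eq_zero {K : Type*} [CommRing K] [Algebra K R] (D : Derivation K R R)
    (A : Matrix n n R) (h : ∀ i k, D (A i k) = 0) : D A.det = 0 := by
  rw [Matrix.det_apply', map_sum]
  refine sum_eq_zero fun σ _ => ?_
  rw [D.leibniz, derivation_prod_eq_zero D _ _ fun i _ => h _ _]
  simp

theorem derivation_pf_eq_zero {K : Type*} [CommRing K] [Algebra K R] (D : Derivation K R R)
    {I : Finset ℕ} {B : ℕ → ℕ → R} (h : ∀ i ∈ I, ∀ j ∈ I, D (B i j) = 0) : D (pf I B) = 0 := by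
  rw [pf, map_sum]
  refine sum_eq_zero fun T hT => derivation_prod_eq_zero D _ _ fun p hp => ?_
  have := (mem_matchings.1 hT).1 p hp
  exact h _ this.2.1 _ this.2.2

theorem derivation_det_of_column {K : Type*} [CommRing K] [Algebra K R] (D : Derivation K R R)
    (A : Matrix n n R) (k : n) (h : ∀ i, ∀ l ≠ k, D (A i l) = 0) :
    D A.det = (A.updateCol k fun i => D (A i k)).det := by
  have hA : A.det = ∑ i, A i k * (A.updateCol k (Pi.single i 1)).det := by
    rw [← det_updateCol_eq_sum A k fun i => A i k]
    exact congrArg Matrix.det (Matrix.updateCol_eq_self A k).symm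
  rw [hA, det_updateCol_eq_sum, map_sum]
  refine sum_congr rfl fun i _ => ?_
  rw [D.leibniz, derivation_det_eq_zero D, smul_zero, zero_add, smul_eq_mul, mul_comm]
  intro r l
  by_cases hl : l = k
  · subst hl
    rw [Matrix.updateCol_self, Pi.single_apply]
    split_ifs <;> simp
  · rw [Matrix.updateCol_ne hl]
    exact h r l hl

end Determinants

theorem pf_map {R : Type*} [CommRing R] (f : ℕ ↪o ℕ) (I : Finset ℕ) (B : ℕ → ℕ → R) :
    pf (I.map f.toEmbedding) B = pf I fun i j => B (f i) (f j) := by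
  induction hn : #I using Nat.strong_induction_on generalizing I with
  | _ n ih =>
    subst hn
    rcases I.eq_empty_or_nonempty with rfl | hI
    · simp [pf_empty]
    · have hi := I.min'_mem hI
      have hmin : ∀ k ∈ I, I.min' hI ≤ k := fun k hk => I.min'_le k hk
      have hfi : f (I.min' hI) ∈ I.map f.toEmbedding := mem_map_of_mem f.toEmbedding hi
      rw [pf_expand hi hmin, pf_expand hfi]
      · have he : (I.map f.toEmbedding).erase (f (I.min' hI)) =
            (I.erase (I.min' hI)).map f.toEmbedding := (map_erase f.toEmbedding I _).symm
        rw [he, sum_map]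
        refine sum_congr rfl fun j hj => ?_
        have hej : ((I.erase (I.min' hI)).map f.toEmbedding).erase (f.toEmbedding j) =
            ((I.erase (I.min' hI)).erase j).map f.toEmbedding := (map_erase f.toEmbedding _ _).symm
        rw [hej, ih _ _ _ rfl]
        · rfl
        · refine lt_of_le_of_lt (card_le_card (erase_subset _ _)) ?_
          exact card_erase_lt_of_mem hi
      · intro k hk
        obtain ⟨k', hk', rfl⟩ := mem_map.1 hk
        exact f.monotone (hmin _ hk')

theorem pf_map_succ {R : Type*} [CommRing R] (I : Finset ℕ) (B : ℕ → ℕ → R) :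
    pf (I.map ⟨Nat.succ, Nat.succ_injective⟩) B = pf I fun i j => B (i + 1) (j + 1) :=
  pf_map (OrderEmbedding.ofStrictMono Nat.succ fun _ _ h => Nat.succ_lt_succ h) I B

theorem sum_erase_eq_sum_lt {R : Type*} [AddCommMonoid R] (n : ℕ) (g : ℕ → ℕ → R) :
    ∑ j ∈ Ioo 0 n, ∑ k ∈ (Ioo 0 n).erase j, g j k =
      ∑ k ∈ Ioo 0 n, ∑ j ∈ Ioo 0 k, (g j k + g k j) := by
  have h1 : ∀ j ∈ Ioo 0 n, ∑ k ∈ (Ioo 0 n).erase j, g j k =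
      ∑ k ∈ Ioo 0 n, (if j < k then g j k else 0) + ∑ k ∈ Ioo 0 n, if k < j then g j k else 0 := by
    intro j _
    rw [← sum_add_distrib, ← filter_ne, sum_filter]
    refine sum_congr rfl fun k _ => ?_
    rcases lt_trichotomy j k with h | h | h
    · simp [h, h.ne, h.not_gt]
    · simp [h]
    · simp [h, h.ne', h.not_gt]
  have h2 : ∀ k ∈ Ioo 0 n, ∀ f : ℕ → R, ∑ j ∈ Ioo 0 k, f j =
      ∑ j ∈ Ioo 0 n, if j < k then f j else 0 := by
    intro k hk f
    have := mem_Ioo.1 hk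
    rw [← sum_filter]
    congr 1
    ext j
    simp only [mem_filter, mem_Ioo]
    omega
  rw [sum_congr rfl h1, sum_add_distrib]
  simp only [sum_add_distrib]
  congr 1
  · rw [sum_comm]
    exact sum_congr rfl fun k hk => (h2 k hk _).symm
  · exact sum_congr rfl fun k hk => (h2 k hk _).symm

section Square

variable (F : Type*) [Field F] [Fintype F] (m : ℕ)

theorem uPrev_pow_card :
    uPrev F m ^ Fintype.card F =
      pf (Ioo 0 (2 * m - 1)) fun i j => xi F m (j - i) ^ Fintype.card F ^ i := by
  have h : Ioo 0 (2 * m - 1) = (range (2 * m - 2)).map ⟨Nat.succ, Nat.succ_injective⟩ := by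
    ext i
    simp only [mem_Ioo, mem_map, mem_range, Function.Embedding.coeFn_mk]
    constructor
    · rintro ⟨h1, h2⟩
      exact ⟨i - 1, by omega, Nat.succ_pred_eq_of_pos h1⟩
    · rintro ⟨k, hk, rfl⟩
      omega
  have hf := frobPow_apply F (R := S F m) 1 (uPrev F m)
  rw [pow_one] at hf
  rw [h, pf_map_succ, ← hf, uPrev, ← AlgHom.coe_toRingHom, map_pf]
  refine pf_congr fun i _ j _ _ => ?_
  rw [AlgHom.coe_toRingHom, frobPow_apply, ← pow_mul, ← pow_add, Nat.add_sub_add_right]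

theorem deltaPair_eq {j k : ℕ} (hj : 0 < j) (hjk : j < k) (hk : k < 2 * m - 1) :
    deltaPair F m j k = pf (((Ioo 0 (2 * m - 1)).erase j).erase k)
      fun i j => xi F m (j - i) ^ Fintype.card F ^ i := by
  have hI : Icc 1 (2 * m - 2) = Ioo 0 (2 * m - 1) := by
    ext i
    simp only [mem_Icc, mem_Ioo]
    omega
  have h1 : j ∈ Ioo 0 (2 * m - 1) := mem_Ioo.2 ⟨hj, by omega⟩
  have h2 : k ∈ (Ioo 0 (2 * m - 1)).erase j := mem_erase.2 ⟨hjk.ne', mem_Ioo.2 ⟨by omega, hk⟩⟩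
  rw [deltaPair, hI, ← add_sum_erase _ _ h1, Nat.add_sub_cancel_left, ← add_sum_erase _ _ h2,
    Nat.add_sub_cancel_left]
  apply naturalSum_eq_pf
  · rw [card_erase_of_mem h2, card_erase_of_mem h1, Nat.card_Ioo]
    omega
  · intro a ha b hb _
    simp only [mem_erase, mem_Ioo] at ha hb
    omega

/-- The columns `e_v, p_0, p_1, …`, where `p_k` consists of the `q ^ k`-th powers. -/
def shiftVec (v : Fin m ⊕ Fin m) : ℕ → Fin m ⊕ Fin m → S F m
  | 0 => Pi.single v 1
  | k + 1 => powVec F m k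

theorem range_erase_zero (n : ℕ) :
    (range (n + 1)).erase 0 = (range n).map ⟨Nat.succ, Nat.succ_injective⟩ := by
  ext i
  simp only [mem_erase, mem_map, mem_range, Function.Embedding.coeFn_mk]
  constructor
  · rintro ⟨h1, h2⟩
    exact ⟨i - 1, by omega, Nat.succ_pred_eq_of_pos (Nat.pos_of_ne_zero h1)⟩
  · rintro ⟨k, hk, rfl⟩
    omega

theorem det_shiftVec [CharP F 2] (hm : 1 ≤ m) (v : Fin m ⊕ Fin m) :
    (colMatrix (shiftVec F m v)).det =
      pderiv v (deltaOne F m) + X v.swap * uPrev F m ^ Fintype.card F := by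
  have : CharP (S F m) 2 := charP_two F
  set Ξ : ℕ → ℕ → S F m := fun i j => xi F m (j - i) ^ Fintype.card F ^ i with hΞ
  set p : ℕ → S F m := fun k => powVec F m k v.swap with hp
  have hIoo : (range (2 * m - 1)).erase 0 = Ioo 0 (2 * m - 1) := by
    ext i
    simp only [mem_erase, mem_range, mem_Ioo]
    omega
  have h2m : 2 * m = 2 * m - 1 + 1 := by omega
  have hexp1 : (colMatrix (shiftVec F m v)).det =
      ∑ j ∈ range (2 * m - 1), p j * pf ((range (2 * m - 1)).erase j) Ξ := by
    rw [det_colMatrix, pf_expand (i := 0) (mem_range.2 (by omega)) fun k _ => Nat.zero_le k]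
    conv_lhs => rw [h2m]
    rw [range_erase_zero, sum_map]
    refine sum_congr rfl fun j _ => ?_
    rw [← map_erase, pf_map_succ]
    congr 1
    · exact pairing_single v _
    · exact pf_powVec F m _
  have hexp2 : ∀ j ∈ Ioo 0 (2 * m - 1), pf ((range (2 * m - 1)).erase j) Ξ =
      ∑ k ∈ (Ioo 0 (2 * m - 1)).erase j,
        xi F m k * pf (((Ioo 0 (2 * m - 1)).erase j).erase k) Ξ := by
    intro j hj
    have hj := mem_Ioo.1 hj
    rw [pf_expand (i := 0) (mem_erase.2 ⟨by omega, mem_range.2 (by omega)⟩)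
      fun k _ => Nat.zero_le k, erase_right_comm, hIoo]
    refine sum_congr rfl fun k _ => ?_
    simp [hΞ]
  have hdelta : pderiv v (deltaOne F m) = ∑ k ∈ Ioo 0 (2 * m - 1), ∑ j ∈ Ioo 0 k,
      (p j * (xi F m k * pf (((Ioo 0 (2 * m - 1)).erase j).erase k) Ξ) +
        p k * (xi F m j * pf (((Ioo 0 (2 * m - 1)).erase k).erase j) Ξ)) := by
    rw [deltaOne, map_sum]
    refine sum_congr rfl fun k hk => ?_
    rw [map_sum]
    refine sum_congr rfl fun j hj => ?_
    have hj := mem_Ioo.1 hj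
    have hk := mem_Ioo.1 hk
    rw [deltaPair_eq F m hj.1 hj.2 hk.2, erase_right_comm (a := k), pderiv_mul, pderiv_mul,
      pderiv_xi F m v hj.1.ne', pderiv_xi F m v hk.1.ne', derivation_pf_eq_zero]
    · simp only [hp, hΞ]
      ring
    · intro a ha b _
      simp only [mem_erase, mem_Ioo] at ha
      exact pderiv_pow_card_pow F v _ (by omega)
  rw [hexp1, ← add_sum_erase _ _ (mem_range.2 (by omega : 0 < 2 * m - 1)), hIoo, hdelta,
    uPrev_pow_card, ← sum_erase_eq_sum_lt (2 * m - 1) fun j k =>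
      p j * (xi F m k * pf (((Ioo 0 (2 * m - 1)).erase j).erase k) Ξ), add_comm]
  congr 1
  · refine sum_congr rfl fun j hj => ?_
    rw [hexp2 j hj, mul_sum]
  · simp [hp, hΞ, powVec]

theorem mooreMinor_varSeq (j : Fin (2 * m + 1)) :
    mooreMinor F (fun i : Fin (2 * m) => varSeq F m i) j =
      (colMatrix fun k => powVec F m (if k < j then k else k + 1)).det := by
  rw [mooreMinor, ← moore_varSeq F m fun k => if k < j then k else k + 1]
  congr 2
  funext k
  by_cases h : (k : ℕ) < j
  · rw [Fin.succAbove_of_castSucc_lt _ _ (by simpa [Fin.lt_def] using h)]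
    simp [h]
  · rw [Fin.succAbove_of_le_castSucc _ _ (by simpa [Fin.le_def] using h)]
    simp [h]

theorem u_mul_dickson [CharP F 2] (hm : 1 ≤ m) :
    u F m * dickson F m 1 =
      (colMatrix fun k => powVec F m (if k < 2 * m - 1 then k else k + 1)).det := by
  have := u_mul_coeff F m ⟨2 * m - 1, by omega⟩
  rw [dickson_eq_coeff, this, mooreMinor_varSeq]

theorem pderiv_xiBar (v : Fin m ⊕ Fin m) : pderiv v (xiBar F m) = X v.swap := by
  classical
  rw [xiBar, map_sum]
  rcases v with j | j
  · rw [sum_eq_single j]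
    · simp [x, y]
    · intro i _ hi
      have : (Sum.inl i : Fin m ⊕ Fin m) ≠ Sum.inl j := by simpa using hi
      simp [x, y, this]
    · simp
  · rw [sum_eq_single j]
    · simp [x, y]
    · intro i _ hi
      have : (Sum.inr i : Fin m ⊕ Fin m) ≠ Sum.inr j := by simpa using hi
      simp [x, y, this]
    · simp

/-- Differentiating the two determinants of `u` and `u d_{1,m}`: the result is a Plücker
relation. -/
theorem pderiv_u_mul [CharP F 2] (hm : 1 ≤ m) (v : Fin m ⊕ Fin m) :
    pderiv v (u F m * (u F m * dickson F m 1)) =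
      u F m ^ Fintype.card F * (colMatrix (shiftVec F m v)).det := by
  have : CharP (S F m) 2 := charP_two F
  set A := colMatrix (powVec F m) with hA
  set i₀ : Fin (2 * m) := ⟨0, by omega⟩ with hi₀
  set j₀ : Fin (2 * m) := ⟨2 * m - 1, by omega⟩ with hj₀
  have hne : i₀ ≠ j₀ := by
    simp only [hi₀, hj₀, ne_eq, Fin.mk.injEq]
    omega
  set P : ℕ → Fin (2 * m) → S F m := fun k r => powVec F m k (revOrder m r) with hP
  set E : Fin (2 * m) → S F m := fun r =>
    (Pi.single v 1 : Fin m ⊕ Fin m → S F m) (revOrder m r) with hE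
  have hE' : ∀ r, pderiv v (X (revOrder m r) : S F m) = E r := by
    intro r
    rw [pderiv_X]
  have val : ∀ k : Fin (2 * m), k ≠ i₀ → (k : ℕ) ≠ 0 := fun k hk h => hk (Fin.ext h)
  have hu : u F m = ((A.updateCol i₀ (P 0)).updateCol j₀ (P (2 * m - 1))).det := by
    rw [u_eq_det_colMatrix]
    congr 1
    ext r k
    rw [Matrix.updateCol_apply, Matrix.updateCol_apply]
    split_ifs with h1 h2
    · rw [h1]; rfl
    · rw [h2]; rfl
    · rfl
  have hu' : u F m * dickson F m 1 =
      ((A.updateCol i₀ (P 0)).updateCol j₀ (P (2 * m))).det := by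
    rw [u_mul_dickson F m hm]
    congr 1
    ext r k
    rw [Matrix.updateCol_apply, Matrix.updateCol_apply]
    split_ifs with h1 h2
    · rw [h1]
      simp [colMatrix, hP, hj₀, Nat.sub_add_cancel (by omega : 1 ≤ 2 * m)]
    · rw [h2]
      have : 0 < 2 * m - 1 := by omega
      simp [colMatrix, hP, hi₀, this]
    · have : (k : ℕ) < 2 * m - 1 := by
        have : (k : ℕ) ≠ 2 * m - 1 := fun h => h1 (Fin.ext h)
        omega
      simp [colMatrix, hA, this]
  have hder : ∀ t ≠ 0, pderiv v ((A.updateCol i₀ (P 0)).updateCol j₀ (P t)).det =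
      ((A.updateCol i₀ E).updateCol j₀ (P t)).det := by
    intro t ht
    rw [derivation_det_of_column _ _ i₀]
    · rw [Matrix.updateCol_comm _ hne.symm, Matrix.updateCol_idem]
      congr 3
      funext r
      rw [Matrix.updateCol_ne hne, Matrix.updateCol_self, ← hE']
      simp [hP, powVec]
    · intro r l hl
      rw [Matrix.updateCol_apply, Matrix.updateCol_ne hl]
      split_ifs
      · exact pderiv_pow_card_pow F v _ ht
      · exact pderiv_pow_card_pow F v _ (val l hl)
  have hq : ((A.updateCol i₀ (P (2 * m - 1))).updateCol j₀ (P (2 * m))).det =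
      u F m ^ Fintype.card F := by
    rw [← det_powVec_succ]
    refine det_eq_of_columns (fun k => if k = i₀ then ⟨2 * m - 2, by omega⟩ else
      if k = j₀ then j₀ else ⟨(k : ℕ) - 1, by omega⟩) ?_ ?_
    · intro k l h
      simp only [Fin.ext_iff, hi₀, hj₀] at h ⊢
      split_ifs at h <;> simp only at h <;> omega
    · intro r k
      rw [Matrix.updateCol_apply, Matrix.updateCol_apply]
      by_cases h1 : k = j₀
      · rw [if_pos h1, if_neg (h1 ▸ hne.symm), if_pos h1]
        simp [colMatrix, hP, hj₀, Nat.sub_add_cancel (by omega : 1 ≤ 2 * m)]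
      · rw [if_neg h1, if_neg h1]
        split_ifs with h2
        · simp [colMatrix, hP, show 2 * m - 2 + 1 = 2 * m - 1 by omega]
        · have := val k h2
          simp [colMatrix, hA, Nat.sub_add_cancel (Nat.pos_of_ne_zero this)]
  have hs : ((A.updateCol i₀ E).updateCol j₀ (P 0)).det = (colMatrix (shiftVec F m v)).det := by
    refine det_eq_of_columns (fun k => if k = i₀ then i₀ else
      if h : (k : ℕ) + 1 < 2 * m then ⟨k + 1, h⟩ else ⟨1, by omega⟩) ?_ ?_
    · intro k l h
      simp only [Fin.ext_iff, hi₀] at h ⊢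
      split_ifs at h <;> simp only at h <;> omega
    · intro r k
      rw [Matrix.updateCol_apply, Matrix.updateCol_apply]
      by_cases h1 : k = j₀
      · rw [if_pos h1, if_neg (h1 ▸ hne.symm), dif_neg (by simp only [h1, hj₀]; omega)]
        rfl
      · rw [if_neg h1]
        split_ifs with h2 h3
        · rfl
        · rfl
        · exact absurd (Fin.ext (by simp only [hj₀]; omega)) h1
  have key := det_updateCol_mul A hne E (P (2 * m - 1)) (P 0) (P (2 * m))
  rw [← hq, pderiv_mul, hu', hu, hder _ (by omega), hder _ (by omega), ← hs]
  rw [mul_comm (Matrix.det _) (Matrix.det ((A.updateCol i₀ (P 0)).updateCol j₀ (P (2 * m)))), key,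
    add_assoc, CharTwo.add_self_eq_zero, add_zero]

theorem exists_b_sq [CharP F 2] (hm : 1 ≤ m) :
    ∃ b : S F m, b ^ 2 = dickson F m 1 + u F m ^ (Fintype.card F - 2) *
      (deltaOne F m + xiBar F m * uPrev F m ^ Fintype.card F) := by
  have : CharP (S F m) 2 := charP_two F
  have hq : 2 ≤ Fintype.card F := Fintype.one_lt_card
  have hpow : ∀ (v) (f : S F m), pderiv v (f ^ Fintype.card F) = 0 := fun v f => by
    have := pderiv_pow_card_pow F v f one_ne_zero
    rwa [pow_one] at this
  set a := dickson F m 1 + u F m ^ (Fintype.card F - 2) *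
      (deltaOne F m + xiBar F m * uPrev F m ^ Fintype.card F) with ha
  suffices h : ∀ v, pderiv v a = 0 by
    obtain ⟨b, hb⟩ := exists_sq_of_pderiv_eq_zero a h
    exact ⟨b, hb.symm⟩
  intro v
  have h1 : u F m ^ 2 * a = u F m * (u F m * dickson F m 1) + u F m ^ Fintype.card F *
      (deltaOne F m + xiBar F m * uPrev F m ^ Fintype.card F) := by
    rw [ha, mul_add, ← mul_assoc (u F m ^ 2) (u F m ^ _), ← pow_add, Nat.add_sub_cancel' hq]
    ring
  have h2 : pderiv v (u F m ^ 2 * a) = u F m ^ 2 * pderiv v a := by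
    rw [pderiv_mul, pderiv_pow]
    simp [CharTwo.two_eq_zero]
  have h3 : pderiv v (u F m ^ 2 * a) = 0 := by
    rw [h1, map_add, pderiv_u_mul F m hm, det_shiftVec F m hm, pderiv_mul, hpow, map_add,
      pderiv_mul, hpow, pderiv_xiBar, zero_mul, zero_add, mul_zero, add_zero,
      CharTwo.add_self_eq_zero]
  rw [h2] at h3
  exact (mul_eq_zero.1 h3).resolve_left (pow_ne_zero _ (u_ne_zero F m))

end Square

end

section

open Finset MvPolynomial

section Forms

variable {F : Type*} [Field F] [Fintype F] {n : Type*} [Fintype n]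

/-- The polynomial `∑ N_ij X_i X_j ^ (q ^ k)`. -/
def form (N : Matrix n n F) (k : ℕ) : MvPolynomial n F :=
  ∑ i, ∑ j, C (N i j) * (X i * X j ^ Fintype.card F ^ k)

theorem form_add (N N' : Matrix n n F) (k : ℕ) : form (N + N') k = form N k + form N' k := by
  simp [form, add_mul, sum_add_distrib]

theorem subst_X_pow (g : Matrix n n F) (i : n) (k : ℕ) :
    subst g (X i) ^ Fintype.card F ^ k = ∑ j, C (g i j) * X j ^ Fintype.card F ^ k := by
  rw [subst_X]
  simp only [← smul_eq_C_mul]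
  exact sum_smul_pow_card_pow F _ _ _ k

theorem subst_form (g N : Matrix n n F) (k : ℕ) :
    subst g (form N k) = form (g.transpose * N * g) k := by
  have h1 : subst g (form N k) = ∑ i, ∑ j, ∑ a, ∑ b,
      C (g i a * N i j * g j b) * (X a * X b ^ Fintype.card F ^ k) := by
    simp only [form, map_sum, map_mul, map_pow]
    refine sum_congr rfl fun i _ => sum_congr rfl fun j _ => ?_
    rw [subst_X_pow, subst_X, sum_mul_sum, mul_sum]
    refine sum_congr rfl fun a _ => ?_
    rw [mul_sum]
    refine sum_congr rfl fun b _ => ?_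
    rw [show subst g (C (N i j)) = C (N i j) from (subst g).commutes _]
    ring
  rw [h1, form]
  simp only [Matrix.mul_apply, Matrix.transpose_apply, map_sum, sum_mul]
  calc
    _ = ∑ j, ∑ i, ∑ a, ∑ b, C (g i a * N i j * g j b) * (X a * X b ^ Fintype.card F ^ k) :=
      sum_comm
    _ = ∑ j, ∑ a, ∑ i, ∑ b, C (g i a * N i j * g j b) * (X a * X b ^ Fintype.card F ^ k) :=
      sum_congr rfl fun j _ => sum_comm
    _ = ∑ j, ∑ a, ∑ b, ∑ i, C (g i a * N i j * g j b) * (X a * X b ^ Fintype.card F ^ k) :=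
      sum_congr rfl fun j _ => sum_congr rfl fun a _ => sum_comm
    _ = ∑ a, ∑ j, ∑ b, ∑ i, C (g i a * N i j * g j b) * (X a * X b ^ Fintype.card F ^ k) :=
      sum_comm
    _ = _ := sum_congr rfl fun a _ => sum_comm

theorem add_transpose_of_form_eq_zero {N : Matrix n n F} (h : form N 0 = 0) :
    N + N.transpose = 0 := by
  classical
  have hv : ∀ v : n → F, ∑ i, ∑ j, N i j * (v i * v j) = 0 := by
    intro v
    have := congrArg (eval v) h
    simpa [form] using this
  have hd : ∀ i, N i i = 0 := by
    intro i
    simpa [Pi.single_apply] using hv (Pi.single i 1)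
  ext i j
  by_cases hij : i = j
  · simp [hij, hd]
  · have := hv (Pi.single i 1 + Pi.single j 1)
    simp only [Pi.add_apply, Pi.single_apply, mul_add, mul_ite, mul_one, mul_zero,
      sum_add_distrib, sum_ite_eq', mem_univ, if_true, hd] at this
    rw [Matrix.add_apply, Matrix.transpose_apply, add_comm]
    simpa [hd] using this

theorem eq_zero_of_form_eq_zero {N : Matrix n n F} {k : ℕ} (hk : k ≠ 0) (h : form N k = 0) :
    N = 0 := by
  classical
  ext i j
  have h1 : pderiv i (form N k) = ∑ j, C (N i j) * X j ^ Fintype.card F ^ k := by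
    rw [form, map_sum, sum_eq_single i]
    · rw [map_sum]
      refine sum_congr rfl fun j _ => ?_
      rw [pderiv_C_mul, pderiv_mul, pderiv_X_self, pderiv_pow_card_pow F i _ hk]
      simp
    · intro a _ ha
      rw [map_sum]
      refine sum_eq_zero fun j _ => ?_
      rw [pderiv_C_mul, pderiv_mul, pderiv_X_of_ne ha, pderiv_pow_card_pow F i _ hk]
      simp
    · simp
  rw [h, map_zero] at h1
  have h2 : (∑ j, N i j • (X j : MvPolynomial n F)) ^ Fintype.card F ^ k = 0 := by
    rw [sum_smul_pow_card_pow, h1]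
    simp only [smul_eq_C_mul]
  have h3 := eq_zero_of_pow_eq_zero h2
  exact Fintype.linearIndependent_iff.1 (linearIndependent_X n F) _ h3 j

theorem form_eq_sq [CharP F 2] {N : Matrix n n F} (h : N + N.transpose = 0) :
    ∃ s : n → F, form N 0 = (∑ i, C (s i) * X i) ^ 2 := by
  classical
  have : CharP (MvPolynomial n F) 2 := charP_two F
  choose s hs using exists_eq_sq (F := F)
  have hsymm : ∀ i j, N j i = N i j := fun i j => by
    have := congrFun (congrFun h i) j
    rw [Matrix.add_apply, Matrix.transpose_apply, Matrix.zero_apply] at this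
    exact (CharTwo.add_eq_zero.1 this).symm
  refine ⟨fun i => s (N i i), ?_⟩
  rw [CharTwo.sum_sq, form, ← sum_product',
    ← sum_filter_add_sum_filter_not _ (fun p : n × n => p.1 = p.2)]
  rw [sum_involution (s := filter (fun p : n × n => ¬ p.1 = p.2) _) (fun p _ => p.swap), add_zero]
  · symm
    refine sum_bij (fun i _ => (i, i)) ?_ ?_ ?_ ?_
    · simp
    · intro i _ j _ h
      exact (Prod.ext_iff.1 h).1
    · rintro ⟨i, j⟩ hp
      have : i = j := (mem_filter.1 hp).2
      exact ⟨i, mem_univ _, by rw [this]⟩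
    · intro i _
      rw [mul_pow, ← map_pow, ← hs]
      simp [sq]
  · rintro ⟨i, j⟩ _
    simp only [Prod.swap, hsymm i j, pow_zero, pow_one]
    rw [mul_comm (X j), CharTwo.add_self_eq_zero]
  · rintro ⟨i, j⟩ hp _ e
    exact (mem_filter.1 hp).2 (Prod.ext_iff.1 e).1.symm
  · rintro ⟨i, j⟩ hp
    simpa [eq_comm] using hp
  · rintro ⟨i, j⟩ _
    rfl

end Forms

section Invariance

variable (F : Type*) [Field F] [Fintype F] (m : ℕ)

/-- The matrix of the quadratic form `x_1 y_1 + ⋯ + x_m y_m`. -/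
def quadMatrix : Matrix (Fin m ⊕ Fin m) (Fin m ⊕ Fin m) F := Matrix.fromBlocks 0 0 1 0

theorem form_quadMatrix (k : ℕ) :
    form (quadMatrix F m) k = ∑ j, x F m j * y F m j ^ Fintype.card F ^ k := by
  simp [form, quadMatrix, x, y, Matrix.one_apply]

theorem form_quadMatrix_transpose (k : ℕ) :
    form (quadMatrix F m).transpose k = ∑ j, y F m j * x F m j ^ Fintype.card F ^ k := by
  simp [form, quadMatrix, x, y, Matrix.one_apply]

theorem xiBar_eq_form : xiBar F m = form (quadMatrix F m) 0 := by
  simp [form_quadMatrix, xiBar]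

theorem xi_eq_form (k : ℕ) :
    xi F m k = form (quadMatrix F m + (quadMatrix F m).transpose) k := by
  rw [form_add, form_quadMatrix, form_quadMatrix_transpose, xi, sum_add_distrib]

/-- The block sum of `N` and the `1 × 1` identity matrix. -/
def extend (N : Matrix (Fin m ⊕ Fin m) (Fin m ⊕ Fin m) F) :
    Matrix (Option (Fin m ⊕ Fin m)) (Option (Fin m ⊕ Fin m)) F
  | none, none => 1
  | some i, some j => N i j
  | none, some _ => 0
  | some _, none => 0

theorem form_extend (N : Matrix (Fin m ⊕ Fin m) (Fin m ⊕ Fin m) F) (k : ℕ) :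
    form (extend F m N) k = z F m * z F m ^ Fintype.card F ^ k + incl F m (form N k) := by
  simp only [form, Fintype.sum_option, extend, map_one, one_mul, map_zero, zero_mul, sum_const_zero,
    add_zero, zero_add, map_sum, map_mul, map_pow, z, incl, rename_X, rename_C]

theorem extend_transpose (N : Matrix (Fin m ⊕ Fin m) (Fin m ⊕ Fin m) F) :
    extend F m N.transpose = (extend F m N).transpose := by
  ext (_ | i) (_ | j) <;> rfl

theorem xiZero_eq_form : xiZero F m = form (extend F m (quadMatrix F m)) 0 := by
  rw [form_extend, xiZero, xiBar_eq_form, pow_zero, pow_one, sq]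

theorem incl_xi_eq_form [CharP F 2] (k : ℕ) : incl F m (xi F m k) =
    form (extend F m (quadMatrix F m) + (extend F m (quadMatrix F m)).transpose) k := by
  have : CharP (Sz F m) 2 := charP_two F
  rw [form_add, ← extend_transpose, form_extend, form_extend, xi_eq_form, form_add, map_add,
    add_add_add_comm, CharTwo.add_self_eq_zero, zero_add]

theorem transpose_mul_mul_of_form_eq {n : Type*} [Fintype n] {g N : Matrix n n F}
    (h : subst g (form N 0) = form N 0) :
    g.transpose * (N + N.transpose) * g = N + N.transpose := by
  rw [subst_form] at h
  have h0 : form (g.transpose * N * g + -N) 0 = 0 := by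
    have hneg : form (-N) 0 = - form N 0 := by simp [form]
    rw [form_add, h, hneg, add_neg_cancel]
  have h1 := add_transpose_of_form_eq_zero h0
  rw [Matrix.transpose_add, Matrix.transpose_neg, Matrix.transpose_mul, Matrix.transpose_mul,
    Matrix.transpose_transpose, ← Matrix.mul_assoc] at h1
  rw [Matrix.mul_add, Matrix.add_mul, ← sub_eq_zero, ← h1]
  abel

theorem subst_incl_xi [CharP F 2]
    {g : Matrix (Option (Fin m ⊕ Fin m)) (Option (Fin m ⊕ Fin m)) F}
    (h : subst g (xiZero F m) = xiZero F m) (k : ℕ) :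
    subst g (incl F m (xi F m k)) = incl F m (xi F m k) := by
  rw [xiZero_eq_form] at h
  rw [incl_xi_eq_form, subst_form, transpose_mul_mul_of_form_eq F h]

variable {F m} in
/-- The elements of a subalgebra containing `ξ_1, …, ξ_{2m}`. -/
theorem mem_of_xi_mem [CharP F 2] (A : Subalgebra F (S F m))
    (h : ∀ k, k ≠ 0 → k ≤ 2 * m → xi F m k ∈ A) :
    u F m ∈ A ∧ uPrev F m ∈ A ∧ deltaOne F m ∈ A ∧
      ∀ j : Fin (2 * m + 1), mooreMinor F (fun i : Fin (2 * m) => varSeq F m i) j ∈ A := by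
  have : CharP (S F m) 2 := charP_two F
  refine ⟨?_, ?_, ?_, ?_⟩
  · rw [u_eq_pf]
    refine pf_mem A fun i hi j hj hij => pow_mem (h _ (by omega) ?_) _
    have := mem_range.1 hj
    omega
  · refine pf_mem A fun i hi j hj hij => pow_mem (h _ (by omega) ?_) _
    have := mem_range.1 hj
    omega
  · refine sum_mem fun k hk => sum_mem fun j hj => ?_
    have hk := mem_Ioo.1 hk
    have hj := mem_Ioo.1 hj
    refine mul_mem (mul_mem (h _ (by omega) (by omega)) (h _ (by omega) (by omega))) ?_
    exact sum_mem fun a _ => prod_mem fun i _ => pow_mem (h _ (by omega) (by omega)) _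
  · intro j
    rw [mooreMinor_varSeq, det_colMatrix]
    refine pf_mem A fun a ha b hb hab => ?_
    have hb := mem_range.1 hb
    rw [pairing_powVec F m (by split_ifs <;> omega)]
    exact pow_mem (h _ (by split_ifs <;> omega) (by split_ifs <;> omega)) _

theorem dickson_one_mul [CharP F 2] (hm : 1 ≤ m) : u F m * dickson F m 1 =
    mooreMinor F (fun i : Fin (2 * m) => varSeq F m i) ⟨2 * m - 1, by omega⟩ := by
  rw [dickson_eq_coeff, ← u_mul_coeff]

variable {F m} in
theorem IsEOne.sq_eq [CharP F 2] {e : Sz F m} (h : IsEOne F m e) :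
    e ^ 2 = incl F m (dickson F m 1 + u F m ^ (Fintype.card F - 2) * deltaOne F m) +
      incl F m (u F m ^ (Fintype.card F - 2) * uPrev F m ^ Fintype.card F) * xiZero F m := by
  have : CharP (Sz F m) 2 := charP_two F
  obtain ⟨w, b, hw, hb, rfl⟩ := h
  rw [isUPrev_iff] at hw
  subst hw
  have hq : 2 ≤ Fintype.card F := Fintype.one_lt_card
  have heven : Fintype.card F % 2 = 0 := FiniteField.even_card_of_char_two (ringChar.eq F 2)
  rw [CharTwo.add_sq, mul_pow, ← map_pow, ← map_pow, hb, mul_pow, ← pow_mul, ← pow_mul,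
    show (Fintype.card F / 2 - 1) * 2 = Fintype.card F - 2 by omega,
    show Fintype.card F / 2 * 2 = Fintype.card F by omega, xiZero]
  simp only [map_add, map_mul]
  ring

variable {F m} in
theorem IsEOne.subst_eq [CharP F 2] (hm : 1 ≤ m) {e : Sz F m} (h : IsEOne F m e)
    {g : Matrix (Option (Fin m ⊕ Fin m)) (Option (Fin m ⊕ Fin m)) F}
    (hg : subst g (xiZero F m) = xiZero F m) : subst g e = e := by
  have : CharP (Sz F m) 2 := charP_two F
  set A : Subalgebra F (S F m) := AlgHom.equalizer ((subst g).comp (incl F m)) (incl F m) with hA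
  have hmem : ∀ s, s ∈ A ↔ subst g (incl F m s) = incl F m s := fun s => Iff.rfl
  obtain ⟨h1, h2, h3, h4⟩ := mem_of_xi_mem A fun k _ _ => subst_incl_xi F m hg k
  have h5 : dickson F m 1 ∈ A := by
    have h6 := h4 ⟨2 * m - 1, by omega⟩
    rw [← dickson_one_mul F m hm, hmem, map_mul, map_mul, (hmem _).1 h1] at h6
    refine mul_left_cancel₀ ?_ h6
    intro h0
    exact u_ne_zero F m (rename_injective _ (Option.some_injective _) (h0.trans (map_zero _).symm))
  apply frobenius_inj (Sz F m) 2
  rw [frobenius_def, frobenius_def, ← map_pow, h.sq_eq, map_add, map_mul, hg,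
    (hmem _).1 (add_mem h5 (mul_mem (pow_mem h1 _) h3)),
    (hmem _).1 (mul_mem (pow_mem h1 _) (pow_mem h2 _))]

end Invariance

end

section

open Finset MvPolynomial

section Galois

variable (F : Type*) [Field F] [Fintype F] (m : ℕ)

/-- The inclusion of `S` in the field of fractions of `S[z]`. -/
def toFrac : S F m →ₐ[F] FractionRing (Sz F m) :=
  (IsScalarTower.toAlgHom F (Sz F m) (FractionRing (Sz F m))).comp (incl F m)

theorem toFrac_apply (f : S F m) :
    toFrac F m f = algebraMap (Sz F m) (FractionRing (Sz F m)) (incl F m f) := rfl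

theorem toFrac_injective : Function.Injective (toFrac F m) :=
  (IsFractionRing.injective (Sz F m) (FractionRing (Sz F m))).comp
    (rename_injective _ (Option.some_injective _))

/-- The field generated by `ξ_1, …, ξ_{2m}` and `e`. -/
abbrev genField (e : Sz F m) : IntermediateField F (FractionRing (Sz F m)) :=
  IntermediateField.adjoin F (algebraMap (Sz F m) (FractionRing (Sz F m)) ''
    (insert e (Set.range fun i : Fin (2 * m) => incl F m (xi F m ((i : ℕ) + 1)))))

variable {F m} {e : Sz F m}

theorem e_mem_genField : algebraMap (Sz F m) (FractionRing (Sz F m)) e ∈ genField F m e :=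
  IntermediateField.subset_adjoin _ _ ⟨e, Set.mem_insert _ _, rfl⟩

theorem toFrac_xi_mem {k : ℕ} (h0 : k ≠ 0) (hk : k ≤ 2 * m) :
    toFrac F m (xi F m k) ∈ genField F m e := by
  refine IntermediateField.subset_adjoin _ _ ⟨_, Set.mem_insert_of_mem _ ⟨⟨k - 1, by omega⟩, rfl⟩, ?_⟩
  simp only [Nat.sub_add_cancel (Nat.pos_of_ne_zero h0)]
  rfl

theorem toFrac_mem_genField [CharP F 2] :
    toFrac F m (u F m) ∈ genField F m e ∧ toFrac F m (uPrev F m) ∈ genField F m e ∧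
      toFrac F m (deltaOne F m) ∈ genField F m e ∧
      ∀ k, toFrac F m ((dicksonPoly F m).coeff k) ∈ genField F m e := by
  obtain ⟨h1, h2, h3, h4⟩ := mem_of_xi_mem ((genField F m e).toSubalgebra.comap (toFrac F m))
    fun k h0 hk => toFrac_xi_mem h0 hk
  refine ⟨h1, h2, h3, fun k => ?_⟩
  by_cases hk : ∃ j : Fin (2 * m + 1), k = Fintype.card F ^ (j : ℕ)
  · obtain ⟨j, rfl⟩ := hk
    have h5 : toFrac F m (mooreMinor F (fun i : Fin (2 * m) => varSeq F m i) j) ∈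
        genField F m e := h4 j
    rw [← u_mul_coeff, map_mul] at h5
    have hu : toFrac F m (u F m) ≠ 0 := fun h =>
      u_ne_zero F m (toFrac_injective F m (h.trans (map_zero _).symm))
    have h1' : toFrac F m (u F m) ∈ genField F m e := h1
    have h6 := div_mem h5 h1'
    rwa [mul_div_cancel_left₀ _ hu] at h6
  · rw [dicksonPoly_coeff_eq_zero F m k fun j hj => hk ⟨j, hj⟩, map_zero]
    exact zero_mem _

theorem xiZero_mem_genField [CharP F 2] (h : IsEOne F m e) :
    algebraMap (Sz F m) (FractionRing (Sz F m)) (xiZero F m) ∈ genField F m e := by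
  obtain ⟨h1, h2, h3, h4⟩ := toFrac_mem_genField (e := e) (F := F) (m := m)
  have hs := congrArg (algebraMap (Sz F m) (FractionRing (Sz F m))) h.sq_eq
  rw [map_add, map_mul, map_pow, ← toFrac_apply, ← toFrac_apply] at hs
  have hne : toFrac F m (u F m ^ (Fintype.card F - 2) * uPrev F m ^ Fintype.card F) ≠ 0 := by
    intro h0
    exact mul_ne_zero (pow_ne_zero _ (u_ne_zero F m)) (pow_ne_zero _ (uPrev_ne_zero F m))
      (toFrac_injective F m (h0.trans (map_zero _).symm))
  have ha : toFrac F m (dickson F m 1 + u F m ^ (Fintype.card F - 2) * deltaOne F m) ∈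
      genField F m e := by
    rw [map_add, map_mul, map_pow, dickson_eq_coeff]
    exact add_mem (h4 _) (mul_mem (pow_mem h1 _) h3)
  have hb : toFrac F m (u F m ^ (Fintype.card F - 2) * uPrev F m ^ Fintype.card F) ∈
      genField F m e := by
    rw [map_mul, map_pow, map_pow]
    exact mul_mem (pow_mem h1 _) (pow_mem h2 _)
  have hx := div_mem (sub_mem (pow_mem e_mem_genField 2) ha) hb
  rwa [hs, add_sub_cancel_left, mul_div_cancel_left₀ _ hne] at hx

theorem map_dicksonPoly :
    (dicksonPoly F m).map (toFrac F m).toRingHom = ∏ c : Fin m ⊕ Fin m → F,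
      (Polynomial.X - Polynomial.C (toFrac F m (linForm F m c))) := by
  rw [dicksonPoly_eq, Polynomial.map_prod]
  refine prod_congr rfl fun c _ => ?_
  rw [Polynomial.map_sub, Polynomial.map_X, Polynomial.map_C]
  rfl

theorem linForm_injective : Function.Injective (linForm F m) := by
  intro c c' h
  have h0 : ∑ i, (c i - c' i) • (X i : S F m) = 0 := by
    simp only [sub_smul, sum_sub_distrib, smul_eq_C_mul]
    exact sub_eq_zero.2 h
  funext i
  exact sub_eq_zero.1 (Fintype.linearIndependent_iff.1 (linearIndependent_X _ F) _ h0 i)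

theorem X_eq_linForm [DecidableEq (Fin m ⊕ Fin m)] (i : Fin m ⊕ Fin m) :
    (X i : S F m) = linForm F m (Pi.single i 1) := by
  rw [linForm, sum_eq_single i]
  · simp
  · intro j _ hj
    simp [Pi.single_eq_of_ne hj]
  · simp

/-- A subfield containing the variables of `S` and `e` is the whole field of fractions. -/
theorem eq_top_of_mem [CharP F 2] (h : IsEOne F m e)
    (M : IntermediateField (genField F m e) (FractionRing (Sz F m)))
    (hX : ∀ i, toFrac F m (X i) ∈ M) : M = ⊤ := by
  have hL : ∀ a ∈ genField F m e, a ∈ M := fun a ha => M.algebraMap_mem ⟨a, ha⟩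
  have hS : ∀ f : S F m, toFrac F m f ∈ M := by
    intro f
    induction f using MvPolynomial.induction_on with
    | C a =>
      have : (C a : S F m) = algebraMap F (S F m) a := rfl
      rw [this, AlgHom.commutes]
      exact hL _ ((genField F m e).algebraMap_mem a)
    | add p q hp hq =>
      rw [map_add]
      exact add_mem hp hq
    | mul_X p i hp =>
      rw [map_mul]
      exact mul_mem hp (hX i)
  have hz : algebraMap (Sz F m) (FractionRing (Sz F m)) (z F m) ∈ M := by
    obtain ⟨w, b, hw, hb, he⟩ := h
    rw [isUPrev_iff] at hw
    have he' := congrArg (algebraMap (Sz F m) (FractionRing (Sz F m))) he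
    rw [map_add, map_mul, ← toFrac_apply, ← toFrac_apply] at he'
    have hne : toFrac F m (u F m ^ (Fintype.card F / 2 - 1) * w ^ (Fintype.card F / 2)) ≠ 0 := by
      intro h0
      refine mul_ne_zero (pow_ne_zero _ (u_ne_zero F m)) (pow_ne_zero _ ?_)
        (toFrac_injective F m (h0.trans (map_zero _).symm))
      rw [hw]
      exact uPrev_ne_zero F m
    have := div_mem (sub_mem (hL _ e_mem_genField) (hS b))
      (hS (u F m ^ (Fintype.card F / 2 - 1) * w ^ (Fintype.card F / 2)))
    rwa [he', add_sub_cancel_right, mul_div_cancel_left₀ _ hne] at this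
  have hall : ∀ f : Sz F m, algebraMap (Sz F m) (FractionRing (Sz F m)) f ∈ M := by
    intro f
    induction f using MvPolynomial.induction_on with
    | C a =>
      have : (C a : Sz F m) = incl F m (C a) := by simp [incl]
      rw [this]
      exact hS _
    | add p q hp hq =>
      rw [map_add]
      exact add_mem hp hq
    | mul_X p i hp =>
      rw [map_mul]
      refine mul_mem hp ?_
      rcases i with _ | i
      · exact hz
      · have : (X (some i) : Sz F m) = incl F m (X i) := by simp [incl]
        rw [this]
        exact hS _
  rw [eq_top_iff]
  intro a _
  obtain ⟨p, q, -, rfl⟩ := IsFractionRing.div_surjective (Sz F m) a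
  exact div_mem (hall p) (hall q)

/-- The field of fractions of `S[z]` is the splitting field of `∏ (t - v)` over the field
generated by `ξ_1, …, ξ_{2m}` and `e_1`. -/
theorem exists_splitting_polynomial [CharP F 2] (h : IsEOne F m e) :
    ∃ p : Polynomial (genField F m e), p.Separable ∧
      p.map (algebraMap (genField F m e) (FractionRing (Sz F m))) =
        ∏ c : Fin m ⊕ Fin m → F, (Polynomial.X - Polynomial.C (toFrac F m (linForm F m c))) ∧
      p.IsSplittingField (genField F m e) (FractionRing (Sz F m)) := by
  classical
  have hl : (dicksonPoly F m).map (toFrac F m).toRingHom ∈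
      Polynomial.lifts (algebraMap (genField F m e) (FractionRing (Sz F m))) := by
    rw [Polynomial.lifts_iff_coeff_lifts]
    intro k
    rw [Polynomial.coeff_map]
    exact ⟨⟨_, toFrac_mem_genField.2.2.2 k⟩, rfl⟩
  obtain ⟨p, hp⟩ := (Polynomial.mem_lifts _).1 hl
  rw [map_dicksonPoly] at hp
  have hsep : p.Separable := by
    rw [← Polynomial.separable_map (algebraMap (genField F m e) (FractionRing (Sz F m))), hp,
      Polynomial.separable_prod_X_sub_C_iff]
    exact (toFrac_injective F m).comp linForm_injective
  refine ⟨p, hsep, hp, isSplittingField_iff_intermediateField.2 ⟨?_, ?_⟩⟩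
  · rw [hp]
    exact Polynomial.Splits.prod fun c _ => Polynomial.Splits.X_sub_C _
  · refine eq_top_of_mem h _ fun i => IntermediateField.subset_adjoin _ _ ?_
    rw [Polynomial.mem_rootSet']
    refine ⟨Polynomial.map_ne_zero hsep.ne_zero, ?_⟩
    rw [Polynomial.aeval_def, ← Polynomial.eval_map, hp, Polynomial.eval_prod]
    refine prod_eq_zero (mem_univ (Pi.single i 1)) ?_
    rw [← X_eq_linForm]
    simp

theorem exists_linForm_of_aut [CharP F 2] (h : IsEOne F m e)
    (σ : FractionRing (Sz F m) ≃ₐ[genField F m e] FractionRing (Sz F m)) (i : Fin m ⊕ Fin m) :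
    ∃ c : Fin m ⊕ Fin m → F, σ (toFrac F m (X i)) = toFrac F m (linForm F m c) := by
  classical
  obtain ⟨p, -, hp, -⟩ := exists_splitting_polynomial h
  have h0 : Polynomial.aeval (toFrac F m (X i)) p = 0 := by
    rw [Polynomial.aeval_def, ← Polynomial.eval_map, hp, Polynomial.eval_prod]
    refine prod_eq_zero (mem_univ (Pi.single i 1)) ?_
    rw [← X_eq_linForm]
    simp
  have h1 : Polynomial.aeval (σ (toFrac F m (X i))) p = 0 := by
    rw [← AlgEquiv.coe_toAlgHom, Polynomial.aeval_algHom_apply, h0, map_zero]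
  rw [Polynomial.aeval_def, ← Polynomial.eval_map, hp, Polynomial.eval_prod, prod_eq_zero_iff] at h1
  obtain ⟨c, -, hc⟩ := h1
  refine ⟨c, ?_⟩
  simpa [sub_eq_zero] using hc

/-- An automorphism over the field generated by `ξ_1, …, ξ_{2m}` and `e_1` is the substitution of
an element of the orthogonal group. -/
theorem exists_matrix_of_aut [CharP F 2] (hm : 1 ≤ m) (h : IsEOne F m e)
    (σ : FractionRing (Sz F m) ≃ₐ[genField F m e] FractionRing (Sz F m)) :
    ∃ g ∈ orthogonalGroup F m, ∀ f : Sz F m,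
      σ (algebraMap (Sz F m) (FractionRing (Sz F m)) f) =
        algebraMap (Sz F m) (FractionRing (Sz F m))
          (subst (g : Matrix (Option (Fin m ⊕ Fin m)) (Option (Fin m ⊕ Fin m)) F) f) := by
  classical
  set K := FractionRing (Sz F m) with hK
  have hcharK : CharP K 2 := charP_two F
  have hcharS : CharP (S F m) 2 := charP_two F
  have hinj : Function.Injective (algebraMap (Sz F m) K) := IsFractionRing.injective _ _
  have hfix : ∀ a ∈ genField F m e, σ a = a := fun a ha => σ.commutes ⟨a, ha⟩
  set τ : K →ₐ[F] K := (σ : K →ₐ[genField F m e] K).restrictScalars F with hτ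
  have hτσ : ∀ a, τ a = σ a := fun a => rfl
  choose A hA using exists_linForm_of_aut h σ
  have hsub : ∀ f : S F m, σ (toFrac F m f) = toFrac F m (subst (Matrix.of A) f) := by
    intro f
    have : τ.comp (toFrac F m) = (toFrac F m).comp (subst (Matrix.of A)) := by
      apply MvPolynomial.algHom_ext
      intro i
      rw [AlgHom.comp_apply, AlgHom.comp_apply, hτσ, hA, subst_X]
      rfl
    exact DFunLike.congr_fun this f
  have hJ : (Matrix.of A).transpose * (quadMatrix F m + (quadMatrix F m).transpose) * Matrix.of A =
      quadMatrix F m + (quadMatrix F m).transpose := by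
    have h1 : subst (Matrix.of A) (xi F m 1) = xi F m 1 := by
      apply toFrac_injective F m
      rw [← hsub, hfix _ (toFrac_xi_mem one_ne_zero (by omega))]
    rw [xi_eq_form, subst_form] at h1
    have h2 : form ((Matrix.of A).transpose * (quadMatrix F m + (quadMatrix F m).transpose) *
        Matrix.of A + (quadMatrix F m + (quadMatrix F m).transpose)) 1 = 0 := by
      rw [form_add, h1, CharTwo.add_self_eq_zero]
    have h3 := eq_zero_of_form_eq_zero one_ne_zero h2
    ext i j
    have := congrFun (congrFun h3 i) j
    rw [Matrix.add_apply, Matrix.zero_apply] at this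
    exact CharTwo.add_eq_zero.1 this
  obtain ⟨s, hs⟩ : ∃ s : Fin m ⊕ Fin m → F,
      subst (Matrix.of A) (xiBar F m) + xiBar F m = linForm F m s ^ 2 := by
    rw [xiBar_eq_form, subst_form, ← form_add]
    apply form_eq_sq
    rw [Matrix.transpose_add, Matrix.transpose_mul, Matrix.transpose_mul,
      Matrix.transpose_transpose, ← Matrix.mul_assoc, add_add_add_comm, ← Matrix.add_mul,
      ← Matrix.mul_add, hJ]
    ext i j
    exact CharTwo.add_self_eq_zero _
  have hz : σ (algebraMap (Sz F m) K (z F m)) =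
      algebraMap (Sz F m) K (z F m) + toFrac F m (linForm F m s) := by
    apply frobenius_inj K 2
    have h1 := hfix _ (xiZero_mem_genField h)
    rw [xiZero, map_add, map_add, map_pow, map_pow, ← toFrac_apply, hsub] at h1
    rw [frobenius_def, frobenius_def, CharTwo.add_sq, ← map_pow (toFrac F m), ← hs, map_add,
      eq_sub_of_add_eq h1, CharTwo.sub_eq_add]
    ring
  set g : Matrix (Option (Fin m ⊕ Fin m)) (Option (Fin m ⊕ Fin m)) F := Matrix.of fun i j =>
    i.elim (j.elim 1 s) fun i => j.elim 0 (A i) with hg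
  have hσ : ∀ f : Sz F m, σ (algebraMap (Sz F m) K f) = algebraMap (Sz F m) K (subst g f) := by
    intro f
    have : τ.comp (IsScalarTower.toAlgHom F (Sz F m) K) =
        (IsScalarTower.toAlgHom F (Sz F m) K).comp (subst g) := by
      apply MvPolynomial.algHom_ext
      intro i
      rw [AlgHom.comp_apply, AlgHom.comp_apply, hτσ, subst_X, Fintype.sum_option]
      rcases i with _ | i
      · change σ (algebraMap (Sz F m) K (z F m)) = algebraMap (Sz F m) K _
        rw [hz, map_add, toFrac_apply]
        congr 2
        · simp [hg, z]
        · simp [hg, linForm, incl]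
      · have hX : (X (some i) : Sz F m) = incl F m (X i) := by simp [incl]
        change σ (algebraMap (Sz F m) K (X (some i))) = algebraMap (Sz F m) K _
        rw [hX, ← toFrac_apply, hA, toFrac_apply]
        congr 1
        simp [hg, linForm, incl]
    exact DFunLike.congr_fun this f
  have hunit : IsUnit g := by
    rw [← Matrix.vecMul_injective_iff_isUnit]
    intro v v' hv
    have h1 : subst g (∑ i, (v i - v' i) • X i) = 0 := by
      have : subst g (∑ i, (v i - v' i) • X i) =
          ∑ j, C (Matrix.vecMul v g j - Matrix.vecMul v' g j) * X j := by
        simp only [map_sum, map_smul, subst_X]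
        simp only [smul_eq_C_mul, Matrix.vecMul, dotProduct, map_sub, map_sum, map_mul, mul_sum]
        rw [sum_comm]
        refine sum_congr rfl fun j _ => ?_
        rw [← sum_sub_distrib, sum_mul]
        exact sum_congr rfl fun i _ => by ring
      rw [this]
      refine sum_eq_zero fun j _ => ?_
      have hj : Matrix.vecMul v g j = Matrix.vecMul v' g j := congrFun hv j
      rw [hj, sub_self, map_zero, zero_mul]
    have h2 : ∑ i, (v i - v' i) • (X i : Sz F m) = 0 := by
      apply hinj
      apply σ.injective
      rw [hσ, h1, map_zero, map_zero]
    funext i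
    exact sub_eq_zero.1 (Fintype.linearIndependent_iff.1 (linearIndependent_X _ F) _ h2 i)
  refine ⟨hunit.unit, ?_, hσ⟩
  change subst g (xiZero F m) = xiZero F m
  apply hinj
  rw [← hσ, hfix _ (xiZero_mem_genField h)]

theorem fieldOfFractions_eq [CharP F 2] (hm : 1 ≤ m) (h : IsEOne F m e) :
    fieldOfFractions (invariants (orthogonalGroup F m)) = genField F m e := by
  apply le_antisymm
  · rw [fieldOfFractions, IntermediateField.adjoin_le_iff]
    rintro _ ⟨f, hf, rfl⟩
    obtain ⟨p, hsep, -, hsplit⟩ := exists_splitting_polynomial h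
    have : IsGalois (genField F m e) (FractionRing (Sz F m)) :=
      IsGalois.of_separable_splitting_field hsep
    have : FiniteDimensional (genField F m e) (FractionRing (Sz F m)) :=
      Polynomial.IsSplittingField.finiteDimensional _ p
    have hb : algebraMap (Sz F m) (FractionRing (Sz F m)) f ∈
        (⊥ : IntermediateField (genField F m e) (FractionRing (Sz F m))) := by
      rw [IsGalois.mem_bot_iff_fixed]
      intro σ
      obtain ⟨g, hg, hσ⟩ := exists_matrix_of_aut hm h σ
      rw [hσ, hf g hg]
    obtain ⟨a, ha⟩ := IntermediateField.mem_bot.1 hb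
    rw [← ha]
    exact a.2
  · rw [IntermediateField.adjoin_le_iff]
    rintro _ ⟨f, hf, rfl⟩
    refine IntermediateField.subset_adjoin _ _ ⟨f, ?_, rfl⟩
    intro g hg
    rcases hf with rfl | ⟨i, rfl⟩
    · exact h.subst_eq hm hg
    · exact subst_incl_xi F m hg _

theorem existsUnique_eOne [CharP F 2] (hm : 1 ≤ m) : ∃! e : Sz F m, IsEOne F m e := by
  have : CharP (S F m) 2 := charP_two F
  obtain ⟨b, hb⟩ := exists_b_sq F m hm
  refine ⟨_, ⟨uPrev F m, b, (isUPrev_iff F m _).2 rfl, hb, rfl⟩, ?_⟩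
  rintro _ ⟨w, b', hw, hb', rfl⟩
  rw [isUPrev_iff] at hw
  subst hw
  have : b' = b := frobenius_inj (S F m) 2 (hb'.trans hb.symm)
  rw [this]

end Galois

end

end OrthInv

end

theorem mainTheorem4 (F : Type*) [Field F] [Fintype F] [CharP F 2] (m : ℕ) (hm : 1 ≤ m) :
    (∃! e : OrthInv.Sz F m, OrthInv.IsEOne F m e) ∧
    ∀ e : OrthInv.Sz F m, OrthInv.IsEOne F m e →
      OrthInv.fieldOfFractions (OrthInv.invariants (OrthInv.orthogonalGroup F m)) =
        IntermediateField.adjoin F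
          (algebraMap (OrthInv.Sz F m) (FractionRing (OrthInv.Sz F m)) ''
            (insert e (Set.range fun i : Fin (2 * m) =>
              OrthInv.incl F m (OrthInv.xi F m ((i : ℕ) + 1))))) :=
  ⟨OrthInv.existsUnique_eOne hm, fun _ h => OrthInv.fieldOfFractions_eq hm h⟩
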